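/- **The system PHOML.** Fix three disjoint infinite sets of variables: term variables $x,y$, proof variables $p,q$, path variables $e$. The syntax, up to $\alpha$-conversion, is $$\begin{array}{lrcl} \text{Type} & A,B &::=& \Omega \mid A\to B\\ \text{Term} & M,N,\varphi,\psi,\chi &::=& x\mid\bot\mid\varphi\supset\psi\mid\lambda x{:}A.M\mid MN\\ \text{Proof} & \delta,\epsilon &::=& p\mid\lambda p{:}\varphi.\delta\mid\delta\epsilon\mid P^+\mid P^-\\ \text{Path} & P,Q &::=& e\mid \mathsf{ref}(M)\mid P\supset^* Q\mid \mathsf{univ}_{\varphi,\psi}(\delta,\epsilon)\mid \lambda\!\!\lambda\!\!\lambda e{:}x=_A y.P\mid P_{MN}Q\\ \text{Context} & \Gamma &::=& \langle\rangle\mid\Gamma,x{:}A\mid\Gamma,p{:}\varphi\mid\Gamma,e{:}M=_AN \end{array}$$ where $\lambda\!\!\lambda\!\!\lambda e{:}x=_Ay.P$ binds the distinct term variables $x,y$ and the path variable $e$ in $P$. $E[z:=F]$ is capture-avoiding substitution. For terms $L,\vec M,\vec N$, paths $\vec P$ and term variables $\vec x$, the path $L\{\vec x:=\vec P:\vec M=\vec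 N\}$, written $L\{\cdot\}$, is given by: $x_i\{\cdot\}=P_i$; $y\{\cdot\}=\mathsf{ref}(y)$ for $y\notin\vec x$; $\bot\{\cdot\}=\mathsf{ref}(\bot)$; $(\varphi\supset\psi)\{\cdot\}=\varphi\{\cdot\}\supset^*\psi\{\cdot\}$; $(LL')\{\cdot\}=L\{\cdot\}_{L'[\vec x:=\vec M]\,L'[\vec x:=\vec N]}L'\{\cdot\}$; $(\lambda y{:}A.L)\{\cdot\}=\lambda\!\!\lambda\!\!\lambda e{:}a=_Aa'.\,L\{\vec x:=\vec P:\vec M=\vec N,\ y:=e:a=a'\}$ with $e,a,a'$ fresh. *Call-by-name reduction* $\to$ is generated as follows. On terms: $(\lambda x{:}A.M)N\to M[x:=N]$, and $\to$ is closed under $MN\to M'N$ (if $M\to M'$) and under both arguments of $\supset$. On proofs: $(\lambda p{:}\varphi.\delta)\epsilon\to\delta[p:=\epsilon]$; $\mathsf{ref}(\varphi)^{\pm}\to\lambda p{:}\varphi.p$; $\mathsf{univ}_{\varphi,\psi}(\delta,\epsilon)^+\to\delta$; $\mathsf{univ}_{\varphi,\psi}(\delta,\epsilon)^-\to\epsilon$;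 $\delta\epsilon\to\delta'\epsilon$ if $\delta\to\delta'$; $P^{\pm}\to Q^{\pm}$ if $P\to Q$. On paths: $$\begin{array}{l} (\lambda\!\!\lambda\!\!\lambda e{:}x=_Ay.P)_{MN}Q\to P[x:=M,y:=N,e:=Q]\\ \mathsf{ref}(\lambda x{:}A.M)_{NN'}P\to M\{x:=P:N=N'\}\\ \mathsf{ref}(\varphi)\supset^*\mathsf{ref}(\psi)\to\mathsf{ref}(\varphi\supset\psi)\\ \mathsf{ref}(\varphi)\supset^*\mathsf{univ}_{\psi,\chi}(\delta,\epsilon)\to\mathsf{univ}_{\varphi\supset\psi,\varphi\supset\chi}(\lambda p{:}\varphi\supset\psi.\lambda q{:}\varphi.\delta(pq),\ \lambda p{:}\varphi\supset\chi.\lambda q{:}\varphi.\epsilon(pq))\\ \mathsf{univ}_{\varphi,\psi}(\delta,\epsilon)\supset^*\mathsf{ref}(\chi)\to\mathsf{univ}_{\varphi\supset\chi,\psi\supset\chi}(\lambda p{:}\varphi\supset\chi.\lambda q{:}\psi.p(\epsilon q),\ \lambda p{:}\psi\supset\chi.\lambda q{:}\varphi.p(\delta q))\\ \mathsf{univ}_{\varphi,\psi}(\delta,\epsilon)\supset^*\mathsf{univ}_{\varphi',\psi'}(\delta',\epsilon')\to\\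 \qquad\mathsf{univ}_{\varphi\supset\varphi',\psi\supset\psi'}(\lambda p{:}\varphi\supset\varphi'.\lambda q{:}\psi.\delta'(p(\epsilon q)),\ \lambda p{:}\psi\supset\psi'.\lambda q{:}\varphi.\epsilon'(p(\delta q))) \end{array}$$ (with $p,q$ fresh), together with $P_{MN}Q\to P'_{MN}Q$ if $P\to P'$; $\mathsf{ref}(M)_{NN'}P\to\mathsf{ref}(M')_{NN'}P$ if $M\to M'$; and closure under both arguments of $\supset^*$. Let $\twoheadrightarrow$ ("reduces to") be the reflexive transitive closure and $\simeq$ the reflexive symmetric transitive closure of $\to$. *Rules of deduction* (variables added to a context are fresh). Contexts: $\langle\rangle$ is valid; $\Gamma,x{:}A$ is valid if $\Gamma$ is; $\Gamma,p{:}\varphi$ is valid if $\Gamma\vdash\varphi:\Omega$; $\Gamma,e{:}M=_AN$ is valid if $\Gamma\vdash M:A$ and $\Gamma\vdash N:A$. If $\Gamma$ is valid, every declaration $z:T$ in $\Gamma$ yields $\Gamma\vdash z:T$. Terms: $\Gamma\vdash\bot:\Omega$ if $\Gamma$ is valid; $\Gamma\vdash\varphi\supset\psi:\Omega$ if $\Gamma\vdash\varphi:\Omega$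 and $\Gamma\vdash\psi:\Omega$; $\Gamma\vdash MN:B$ if $\Gamma\vdash M:A\to B$ and $\Gamma\vdash N:A$; $\Gamma\vdash\lambda x{:}A.M:A\to B$ if $\Gamma,x{:}A\vdash M:B$. Proofs: $\Gamma\vdash\delta\epsilon:\psi$ if $\Gamma\vdash\delta:\varphi\supset\psi$ and $\Gamma\vdash\epsilon:\varphi$; $\Gamma\vdash\lambda p{:}\varphi.\delta:\varphi\supset\psi$ if $\Gamma,p{:}\varphi\vdash\delta:\psi$; $\Gamma\vdash\delta:\psi$ if $\Gamma\vdash\delta:\varphi$, $\Gamma\vdash\psi:\Omega$ and $\varphi\simeq\psi$; and if $\Gamma\vdash P:\varphi=_\Omega\psi$ then $\Gamma\vdash P^+:\varphi\supset\psi$ and $\Gamma\vdash P^-:\psi\supset\varphi$. Paths: $\Gamma\vdash\mathsf{ref}(M):M=_AM$ if $\Gamma\vdash M:A$; $\Gamma\vdash P\supset^*Q:\varphi\supset\psi=_\Omega\varphi'\supset\psi'$ if $\Gamma\vdash P:\varphi=_\Omega\varphi'$ and $\Gamma\vdash Q:\psi=_\Omega\psi'$; $\Gamma\vdash\mathsf{univ}_{\varphi,\psi}(\delta,\epsilon):\varphi=_\Omega\psi$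 if $\Gamma\vdash\delta:\varphi\supset\psi$ and $\Gamma\vdash\epsilon:\psi\supset\varphi$; $\Gamma\vdash\lambda\!\!\lambda\!\!\lambda e{:}x=_Ay.P:M=_{A\to B}N$ if $\Gamma,x{:}A,y{:}A,e{:}x=_Ay\vdash P:Mx=_BNy$, $\Gamma\vdash M:A\to B$ and $\Gamma\vdash N:A\to B$; $\Gamma\vdash P_{NN'}Q:MN=_BM'N'$ if $\Gamma\vdash P:M=_{A\to B}M'$, $\Gamma\vdash Q:N=_AN'$, $\Gamma\vdash N:A$ and $\Gamma\vdash N':A$; $\Gamma\vdash P:M'=_AN'$ if $\Gamma\vdash P:M=_AN$, $\Gamma\vdash M':A$, $\Gamma\vdash N':A$, $M\simeq M'$ and $N\simeq N'$. *Neutral* proofs $\delta_n$ and paths $P_n$ are given by $\delta_n::=p\mid P_n^+\mid P_n^-\mid\delta_n\epsilon$ and $P_n::=e\mid P_n\supset^*Q\mid Q\supset^*P_n\mid (P_n)_{MN}Q$, with $\epsilon,Q,M,N$ arbitrary. **Corollary (Canonicity).** Let $\Gamma$ be a context with no term variables. 1. If $\Gamma\vdash\delta:\bot$, then $\delta$ reduces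 to a neutral proof. 2. If $\Gamma\vdash\delta:\varphi\supset\psi$, then $\delta$ reduces either to a neutral proof, or to a proof $\lambda p{:}\varphi'.\epsilon$ where $\varphi\simeq\varphi'$ and $\Gamma,p{:}\varphi\vdash\epsilon:\psi$. 3. If $\Gamma\vdash P:\varphi=_\Omega\psi$, then $P$ reduces either to a neutral path; or to $\mathsf{ref}(\chi)$ where $\varphi\simeq\psi\simeq\chi$; or to $\mathsf{univ}_{\varphi',\psi'}(\delta,\epsilon)$ where $\varphi\simeq\varphi'$, $\psi\simeq\psi'$, $\Gamma\vdash\delta:\varphi\supset\psi$ and $\Gamma\vdash\epsilon:\psi\supset\varphi$. 4. If $\Gamma\vdash P:M=_{A\to B}M'$, then $P$ reduces either to a neutral path; or to $\mathsf{ref}(N)$ where $M\simeq M'\simeq N$; or to $\lambda\!\!\lambda\!\!\lambda e{:}x=_Ay.Q$ where $\Gamma,x{:}A,y{:}A,e{:}x=_Ay\vdash Q:Mx=_BM'y$. -/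

import Mathlib

/-! The system PHOML (predicative higher-order minimal logic with extensional equality).

Expressions are taken up to alpha-conversion by means of de Bruijn indices.  There are three separate
index spaces, for term variables, proof variables and path variables; in each of them index `0`
denotes the variable of that sort that was bound last. -/

namespace PHOML

/-- Types: the simple types over `Ω`. -/
inductive Ty : Type
  | omega : Ty
  | arrow : Ty → Ty → Ty

/-- Terms. -/
inductive Tm : Type
  | var : ℕ → Tm
  | bot : Tm
  | imp : Tm → Tm → Tm
  | lam : Ty → Tm → Tm
  | app : Tm → Tm → Tm

mutual
/-- Proofs. `Prf.lam φ δ` binds one proof variable in `δ`. -/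
inductive Prf : Type
  | var : ℕ → Prf
  | lam : Tm → Prf → Prf
  | app : Prf → Prf → Prf
  | plus : Pth → Prf
  | minus : Pth → Prf
/-- Paths. `Pth.lll A P` is the triple-lambda path on `e : x =_A y` with body `P`: it binds the term
variables `x`, `y` (in this order, so that `x` has index `1` and `y` has index `0` in `P`) and the
path variable `e`. `Pth.app P M N Q` is `P` applied to `Q` with subscripts `M`, `N`. -/
inductive Pth : Type
  | var : ℕ → Pth
  | ref : Tm → Pth
  | impStar : Pth → Pth → Pth
  | univ : Tm → Tm → Prf → Prf → Pth
  | lll : Ty → Pth → Pth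
  | app : Pth → Tm → Tm → Pth → Pth
end

/-- The sequence `a, f 0, f 1, …`. -/
def cons {α : Type} (a : α) (f : ℕ → α) : ℕ → α
  | 0 => a
  | n + 1 => f n

/-! ### Renaming -/

/-- Extend a renaming under a binder. -/
def upRen (ξ : ℕ → ℕ) : ℕ → ℕ := cons 0 (fun n => ξ n + 1)

def Tm.rename : (ℕ → ℕ) → Tm → Tm
  | ξ, .var n => .var (ξ n)
  | _, .bot => .bot
  | ξ, .imp φ ψ => .imp (φ.rename ξ) (ψ.rename ξ)
  | ξ, .lam A M => .lam A (M.rename (upRen ξ))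
  | ξ, .app M N => .app (M.rename ξ) (N.rename ξ)

mutual
/-- Rename the term variables by `ξ`, the proof variables by `ζ`, the path variables by `η`. -/
def Prf.rename : (ℕ → ℕ) → (ℕ → ℕ) → (ℕ → ℕ) → Prf → Prf
  | _, ζ, _, .var n => .var (ζ n)
  | ξ, ζ, η, .lam φ δ => .lam (φ.rename ξ) (δ.rename ξ (upRen ζ) η)
  | ξ, ζ, η, .app δ ε => .app (δ.rename ξ ζ η) (ε.rename ξ ζ η)
  | ξ, ζ, η, .plus P => .plus (P.rename ξ ζ η)
  | ξ, ζ, η, .minus P => .minus (P.rename ξ ζ η)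
/-- Rename the term variables by `ξ`, the proof variables by `ζ`, the path variables by `η`. -/
def Pth.rename : (ℕ → ℕ) → (ℕ → ℕ) → (ℕ → ℕ) → Pth → Pth
  | _, _, η, .var n => .var (η n)
  | ξ, _, _, .ref M => .ref (M.rename ξ)
  | ξ, ζ, η, .impStar P Q => .impStar (P.rename ξ ζ η) (Q.rename ξ ζ η)
  | ξ, ζ, η, .univ φ ψ δ ε =>
      .univ (φ.rename ξ) (ψ.rename ξ) (δ.rename ξ ζ η) (ε.rename ξ ζ η)
  | ξ, ζ, η, .lll A P => .lll A (P.rename (upRen (upRen ξ)) ζ (upRen η))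
  | ξ, ζ, η, .app P M N Q =>
      .app (P.rename ξ ζ η) (M.rename ξ) (N.rename ξ) (Q.rename ξ ζ η)
end

/-- Weaken a term by one new term variable. -/
def Tm.shift (M : Tm) : Tm := M.rename (fun n => n + 1)

/-- Weaken a term by two new term variables. -/
def Tm.shift2 (M : Tm) : Tm := M.rename (fun n => n + 2)

/-- Weaken a proof by one new proof variable. -/
def Prf.shiftP (δ : Prf) : Prf := δ.rename id (fun n => n + 1) id

/-- Weaken a proof by two new proof variables. -/
def Prf.shiftP2 (δ : Prf) : Prf := δ.rename id (fun n => n + 2) id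

/-- Weaken a path by one new proof variable. -/
def Pth.shiftP (P : Pth) : Pth := P.rename id (fun n => n + 1) id

/-- Weaken a proof by two new term variables and one new path variable. -/
def Prf.shiftL (δ : Prf) : Prf := δ.rename (fun n => n + 2) id (fun n => n + 1)

/-- Weaken a path by two new term variables and one new path variable. -/
def Pth.shiftL (P : Pth) : Pth := P.rename (fun n => n + 2) id (fun n => n + 1)

/-! ### Simultaneous capture-avoiding substitution -/

/-- Extend a substitution for term variables under a binder of a term variable. -/
def upTm (σ : ℕ → Tm) : ℕ → Tm := cons (.var 0) (fun n => (σ n).shift)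

def Tm.subst : (ℕ → Tm) → Tm → Tm
  | σ, .var n => σ n
  | _, .bot => .bot
  | σ, .imp φ ψ => .imp (φ.subst σ) (ψ.subst σ)
  | σ, .lam A M => .lam A (M.subst (upTm σ))
  | σ, .app M N => .app (M.subst σ) (N.subst σ)

mutual
/-- Substitute `σ` for the term variables, `π` for the proof variables, `κ` for the path
variables. -/
def Prf.subst : (ℕ → Tm) → (ℕ → Prf) → (ℕ → Pth) → Prf → Prf
  | _, π, _, .var n => π n
  | σ, π, κ, .lam φ δ =>
      .lam (φ.subst σ)
        (δ.subst σ (cons (.var 0) (fun n => (π n).shiftP)) (fun n => (κ n).shiftP))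
  | σ, π, κ, .app δ ε => .app (δ.subst σ π κ) (ε.subst σ π κ)
  | σ, π, κ, .plus P => .plus (P.subst σ π κ)
  | σ, π, κ, .minus P => .minus (P.subst σ π κ)
/-- Substitute `σ` for the term variables, `π` for the proof variables, `κ` for the path
variables. -/
def Pth.subst : (ℕ → Tm) → (ℕ → Prf) → (ℕ → Pth) → Pth → Pth
  | _, _, κ, .var n => κ n
  | σ, _, _, .ref M => .ref (M.subst σ)
  | σ, π, κ, .impStar P Q => .impStar (P.subst σ π κ) (Q.subst σ π κ)
  | σ, π, κ, .univ φ ψ δ ε =>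
      .univ (φ.subst σ) (ψ.subst σ) (δ.subst σ π κ) (ε.subst σ π κ)
  | σ, π, κ, .lll A P =>
      .lll A (P.subst (upTm (upTm σ)) (fun n => (π n).shiftL)
        (cons (.var 0) (fun n => (κ n).shiftL)))
  | σ, π, κ, .app P M N Q =>
      .app (P.subst σ π κ) (M.subst σ) (N.subst σ) (Q.subst σ π κ)
end

/-- `M[x := N]`, where `x` is the last term variable. -/
def Tm.inst (M N : Tm) : Tm := M.subst (cons N .var)

/-- `δ[p := ε]`, where `p` is the last proof variable. -/
def Prf.inst (δ ε : Prf) : Prf := δ.subst .var (cons ε .var) .var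

/-- `P[x := M, y := N, e := Q]`, for the variables bound by the triple lambda. -/
def Pth.inst (P : Pth) (M N : Tm) (Q : Pth) : Pth :=
  P.subst (cons N (cons M .var)) .var (cons Q .var)

/-! ### Path substitution -/

/-- The simultaneous path substitution `L{τ : ρ = σ}`. A variable `x` that is not meant to be
substituted is given the values `τ x = ref x` and `ρ x = σ x = x`. Under a `λ y`, the variable `y` is
sent to the path variable `e : a = a'` that is bound, with `a`, `a'`, by the new triple lambda. -/
def Tm.pathSubst : (ℕ → Pth) → (ℕ → Tm) → (ℕ → Tm) → Tm → Pth
  | τ, _, _, .var n => τ n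
  | _, _, _, .bot => .ref .bot
  | τ, ρ, σ, .imp φ ψ => .impStar (φ.pathSubst τ ρ σ) (ψ.pathSubst τ ρ σ)
  | τ, ρ, σ, .lam A L =>
      .lll A (L.pathSubst
        (cons (.var 0) (fun n => (τ n).shiftL))
        (cons (.var 1) (fun n => (ρ n).shift2))
        (cons (.var 0) (fun n => (σ n).shift2)))
  | τ, ρ, σ, .app L L' =>
      .app (L.pathSubst τ ρ σ) (L'.subst ρ) (L'.subst σ) (L'.pathSubst τ ρ σ)

/-- `M{x := P : N = N'}`, where `x` is the last term variable. -/
def Tm.pathInst (M : Tm) (P : Pth) (N N' : Tm) : Pth :=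
  M.pathSubst (cons P (fun n => .ref (.var n))) (cons N .var) (cons N' .var)

/-! ### Call-by-name reduction -/

/-- One-step reduction on terms. -/
inductive TmRed : Tm → Tm → Prop
  | beta (A : Ty) (M N : Tm) : TmRed (.app (.lam A M) N) (M.inst N)
  | app {M M' : Tm} (N : Tm) : TmRed M M' → TmRed (.app M N) (.app M' N)
  | impL {φ φ' : Tm} (ψ : Tm) : TmRed φ φ' → TmRed (.imp φ ψ) (.imp φ' ψ)
  | impR (φ : Tm) {ψ ψ' : Tm} : TmRed ψ ψ' → TmRed (.imp φ ψ) (.imp φ ψ')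

/-- One-step reduction on paths. In a proof `λ p. λ q. …`, the variable `p` has index `1` and `q` has
index `0`. -/
inductive PthRed : Pth → Pth → Prop
  | beta (A : Ty) (P : Pth) (M N : Tm) (Q : Pth) :
      PthRed (.app (.lll A P) M N Q) (P.inst M N Q)
  | refLam (A : Ty) (M N N' : Tm) (P : Pth) :
      PthRed (.app (.ref (.lam A M)) N N' P) (M.pathInst P N N')
  | refRef (φ ψ : Tm) : PthRed (.impStar (.ref φ) (.ref ψ)) (.ref (.imp φ ψ))
  | refUniv (φ ψ χ : Tm) (δ ε : Prf) :
      PthRed (.impStar (.ref φ) (.univ ψ χ δ ε))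
        (.univ (.imp φ ψ) (.imp φ χ)
          (.lam (.imp φ ψ) (.lam φ (.app δ.shiftP2 (.app (.var 1) (.var 0)))))
          (.lam (.imp φ χ) (.lam φ (.app ε.shiftP2 (.app (.var 1) (.var 0))))))
  | univRef (φ ψ χ : Tm) (δ ε : Prf) :
      PthRed (.impStar (.univ φ ψ δ ε) (.ref χ))
        (.univ (.imp φ χ) (.imp ψ χ)
          (.lam (.imp φ χ) (.lam ψ (.app (.var 1) (.app ε.shiftP2 (.var 0)))))
          (.lam (.imp ψ χ) (.lam φ (.app (.var 1) (.app δ.shiftP2 (.var 0))))))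
  | univUniv (φ ψ φ' ψ' : Tm) (δ ε δ' ε' : Prf) :
      PthRed (.impStar (.univ φ ψ δ ε) (.univ φ' ψ' δ' ε'))
        (.univ (.imp φ φ') (.imp ψ ψ')
          (.lam (.imp φ φ') (.lam ψ
            (.app δ'.shiftP2 (.app (.var 1) (.app ε.shiftP2 (.var 0))))))
          (.lam (.imp ψ ψ') (.lam φ
            (.app ε'.shiftP2 (.app (.var 1) (.app δ.shiftP2 (.var 0)))))))
  | app {P P' : Pth} (M N : Tm) (Q : Pth) : PthRed P P' → PthRed (.app P M N Q) (.app P' M N Q)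
  | appRef {M M' : Tm} (N N' : Tm) (P : Pth) :
      TmRed M M' → PthRed (.app (.ref M) N N' P) (.app (.ref M') N N' P)
  | impStarL {P P' : Pth} (Q : Pth) : PthRed P P' → PthRed (.impStar P Q) (.impStar P' Q)
  | impStarR (P : Pth) {Q Q' : Pth} : PthRed Q Q' → PthRed (.impStar P Q) (.impStar P Q')

/-- One-step reduction on proofs. -/
inductive PrfRed : Prf → Prf → Prop
  | beta (φ : Tm) (δ ε : Prf) : PrfRed (.app (.lam φ δ) ε) (δ.inst ε)
  | refPlus (φ : Tm) : PrfRed (.plus (.ref φ)) (.lam φ (.var 0))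
  | refMinus (φ : Tm) : PrfRed (.minus (.ref φ)) (.lam φ (.var 0))
  | app {δ δ' : Prf} (ε : Prf) : PrfRed δ δ' → PrfRed (.app δ ε) (.app δ' ε)
  | univPlus (φ ψ : Tm) (δ ε : Prf) : PrfRed (.plus (.univ φ ψ δ ε)) δ
  | univMinus (φ ψ : Tm) (δ ε : Prf) : PrfRed (.minus (.univ φ ψ δ ε)) ε
  | plus {P Q : Pth} : PthRed P Q → PrfRed (.plus P) (.plus Q)
  | minus {P Q : Pth} : PthRed P Q → PrfRed (.minus P) (.minus Q)

/-- Convertibility of terms: the equivalence relation generated by reduction. -/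
def TmConv : Tm → Tm → Prop := Relation.EqvGen TmRed

/-- Multi-step reduction of proofs. -/
def PrfReduces : Prf → Prf → Prop := Relation.ReflTransGen PrfRed

/-- Multi-step reduction of paths. -/
def PthReduces : Pth → Pth → Prop := Relation.ReflTransGen PthRed

/-! ### Contexts, judgements and the rules of deduction -/

/-- Contexts: `Γ, x : A`, `Γ, p : φ` and `Γ, e : M =_A N`. -/
inductive Ctx : Type
  | nil : Ctx
  | tm : Ctx → Ty → Ctx
  | pf : Ctx → Tm → Ctx
  | path : Ctx → Tm → Ty → Tm → Ctx

/-- `Γ` declares no term variable. -/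
def Ctx.NoTermVars : Ctx → Prop
  | .nil => True
  | .tm _ _ => False
  | .pf Γ _ => Γ.NoTermVars
  | .path Γ _ _ _ => Γ.NoTermVars

/-- `x : A ∈ Γ` -/
inductive Ctx.HasTm : Ctx → ℕ → Ty → Prop
  | here (Γ : Ctx) (A : Ty) : HasTm (.tm Γ A) 0 A
  | tm {Γ : Ctx} {n : ℕ} {A : Ty} (B : Ty) : HasTm Γ n A → HasTm (.tm Γ B) (n + 1) A
  | pf {Γ : Ctx} {n : ℕ} {A : Ty} (φ : Tm) : HasTm Γ n A → HasTm (.pf Γ φ) n A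
  | path {Γ : Ctx} {n : ℕ} {A : Ty} (M : Tm) (B : Ty) (N : Tm) :
      HasTm Γ n A → HasTm (.path Γ M B N) n A

/-- `p : φ ∈ Γ` -/
inductive Ctx.HasPf : Ctx → ℕ → Tm → Prop
  | here (Γ : Ctx) (φ : Tm) : HasPf (.pf Γ φ) 0 φ
  | tm {Γ : Ctx} {n : ℕ} {φ : Tm} (B : Ty) : HasPf Γ n φ → HasPf (.tm Γ B) n φ.shift
  | pf {Γ : Ctx} {n : ℕ} {φ : Tm} (ψ : Tm) : HasPf Γ n φ → HasPf (.pf Γ ψ) (n + 1) φ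
  | path {Γ : Ctx} {n : ℕ} {φ : Tm} (M : Tm) (B : Ty) (N : Tm) :
      HasPf Γ n φ → HasPf (.path Γ M B N) n φ

/-- `e : M =_A N ∈ Γ` -/
inductive Ctx.HasPath : Ctx → ℕ → Tm → Ty → Tm → Prop
  | here (Γ : Ctx) (M : Tm) (A : Ty) (N : Tm) : HasPath (.path Γ M A N) 0 M A N
  | tm {Γ : Ctx} {n : ℕ} {M N : Tm} {A : Ty} (B : Ty) :
      HasPath Γ n M A N → HasPath (.tm Γ B) n M.shift A N.shift
  | pf {Γ : Ctx} {n : ℕ} {M N : Tm} {A : Ty} (φ : Tm) :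
      HasPath Γ n M A N → HasPath (.pf Γ φ) n M A N
  | path {Γ : Ctx} {n : ℕ} {M N : Tm} {A : Ty} (M' : Tm) (B : Ty) (N' : Tm) :
      HasPath Γ n M A N → HasPath (.path Γ M' B N') (n + 1) M A N

/-- What may stand to the right of the turnstile: `valid`, `M : A`, `δ : φ`, `P : M =_A N`. -/
inductive Judgement : Type
  | valid : Judgement
  | tm : Tm → Ty → Judgement
  | pf : Prf → Tm → Judgement
  | path : Pth → Tm → Ty → Tm → Judgement

/-- `Γ, x : A, y : A, e : x =_A y` -/
def Ctx.ext3 (Γ : Ctx) (A : Ty) : Ctx := .path (.tm (.tm Γ A) A) (.var 1) A (.var 0)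

/-- Derivability of judgements. -/
inductive Derives : Ctx → Judgement → Prop
  | ctxNil : Derives .nil .valid
  | ctxT {Γ : Ctx} (A : Ty) : Derives Γ .valid → Derives (.tm Γ A) .valid
  | ctxP {Γ : Ctx} {φ : Tm} : Derives Γ (.tm φ .omega) → Derives (.pf Γ φ) .valid
  | ctxE {Γ : Ctx} {M N : Tm} {A : Ty} :
      Derives Γ (.tm M A) → Derives Γ (.tm N A) → Derives (.path Γ M A N) .valid
  | varT {Γ : Ctx} {n : ℕ} {A : Ty} :
      Derives Γ .valid → Γ.HasTm n A → Derives Γ (.tm (.var n) A)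
  | varP {Γ : Ctx} {n : ℕ} {φ : Tm} :
      Derives Γ .valid → Γ.HasPf n φ → Derives Γ (.pf (.var n) φ)
  | varE {Γ : Ctx} {n : ℕ} {M N : Tm} {A : Ty} :
      Derives Γ .valid → Γ.HasPath n M A N → Derives Γ (.path (.var n) M A N)
  | bot {Γ : Ctx} : Derives Γ .valid → Derives Γ (.tm .bot .omega)
  | imp {Γ : Ctx} {φ ψ : Tm} :
      Derives Γ (.tm φ .omega) → Derives Γ (.tm ψ .omega) → Derives Γ (.tm (.imp φ ψ) .omega)
  | appT {Γ : Ctx} {M N : Tm} {A B : Ty} :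
      Derives Γ (.tm M (.arrow A B)) → Derives Γ (.tm N A) → Derives Γ (.tm (.app M N) B)
  | lamT {Γ : Ctx} {M : Tm} {A B : Ty} :
      Derives (.tm Γ A) (.tm M B) → Derives Γ (.tm (.lam A M) (.arrow A B))
  | appP {Γ : Ctx} {δ ε : Prf} {φ ψ : Tm} :
      Derives Γ (.pf δ (.imp φ ψ)) → Derives Γ (.pf ε φ) → Derives Γ (.pf (.app δ ε) ψ)
  | lamP {Γ : Ctx} {δ : Prf} {φ ψ : Tm} :
      Derives (.pf Γ φ) (.pf δ ψ) → Derives Γ (.pf (.lam φ δ) (.imp φ ψ))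
  | convP {Γ : Ctx} {δ : Prf} {φ ψ : Tm} :
      Derives Γ (.pf δ φ) → Derives Γ (.tm ψ .omega) → TmConv φ ψ → Derives Γ (.pf δ ψ)
  | ref {Γ : Ctx} {M : Tm} {A : Ty} : Derives Γ (.tm M A) → Derives Γ (.path (.ref M) M A M)
  | impStar {Γ : Ctx} {P Q : Pth} {φ φ' ψ ψ' : Tm} :
      Derives Γ (.path P φ .omega φ') → Derives Γ (.path Q ψ .omega ψ') →
      Derives Γ (.path (.impStar P Q) (.imp φ ψ) .omega (.imp φ' ψ'))
  | univ {Γ : Ctx} {δ ε : Prf} {φ ψ : Tm} :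
      Derives Γ (.pf δ (.imp φ ψ)) → Derives Γ (.pf ε (.imp ψ φ)) →
      Derives Γ (.path (.univ φ ψ δ ε) φ .omega ψ)
  | plus {Γ : Ctx} {P : Pth} {φ ψ : Tm} :
      Derives Γ (.path P φ .omega ψ) → Derives Γ (.pf (.plus P) (.imp φ ψ))
  | minus {Γ : Ctx} {P : Pth} {φ ψ : Tm} :
      Derives Γ (.path P φ .omega ψ) → Derives Γ (.pf (.minus P) (.imp ψ φ))
  | lll {Γ : Ctx} {P : Pth} {M N : Tm} {A B : Ty} :
      Derives (Γ.ext3 A) (.path P (.app M.shift2 (.var 1)) B (.app N.shift2 (.var 0))) →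
      Derives Γ (.tm M (.arrow A B)) → Derives Γ (.tm N (.arrow A B)) →
      Derives Γ (.path (.lll A P) M (.arrow A B) N)
  | appE {Γ : Ctx} {P Q : Pth} {M M' N N' : Tm} {A B : Ty} :
      Derives Γ (.path P M (.arrow A B) M') → Derives Γ (.path Q N A N') →
      Derives Γ (.tm N A) → Derives Γ (.tm N' A) →
      Derives Γ (.path (.app P N N' Q) (.app M N) B (.app M' N'))
  | convE {Γ : Ctx} {P : Pth} {M M' N N' : Tm} {A : Ty} :
      Derives Γ (.path P M A N) → Derives Γ (.tm M' A) → Derives Γ (.tm N' A) →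
      TmConv M M' → TmConv N N' → Derives Γ (.path P M' A N')

/-! ### Neutral expressions -/

/-- Neutral paths. -/
inductive NeutralPth : Pth → Prop
  | var (n : ℕ) : NeutralPth (.var n)
  | impStarL {P : Pth} (Q : Pth) : NeutralPth P → NeutralPth (.impStar P Q)
  | impStarR (Q : Pth) {P : Pth} : NeutralPth P → NeutralPth (.impStar Q P)
  | app {P : Pth} (M N : Tm) (Q : Pth) : NeutralPth P → NeutralPth (.app P M N Q)

/-- Neutral proofs. -/
inductive NeutralPrf : Prf → Prop
  | var (n : ℕ) : NeutralPrf (.var n)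
  | plus {P : Pth} : NeutralPth P → NeutralPrf (.plus P)
  | minus {P : Pth} : NeutralPth P → NeutralPrf (.minus P)
  | app {δ : Prf} (ε : Prf) : NeutralPrf δ → NeutralPrf (.app δ ε)

end PHOML

open PHOML

namespace PHOML

open Relation

-- The method is Tait's computability argument. Computability is a predicate on raw expressions: it
-- mentions neither contexts nor typing, so it says what an expression reduces to, and the typing of
-- the reduct is recovered separately.
--
-- Call-by-name reduction of terms enters neither abstractions nor arguments of applications, so the
-- only competing steps are those in the two sides of an implication. This makes it confluent
-- (`TmRed.diamond`). Hence `⊃` is injective up to `≃`, and a term reduces to at most one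
-- proposition built from `⊥` and `⊃`, shared by all terms convertible to it. That canonical
-- proposition `θ` can serve as the index of a recursion: `CPrf θ` describes computable proofs,
-- requiring at an implication both a value of the right shape and the preservation of computability
-- under application. A path between propositions is computable if its ends have canonical forms and
-- it reduces to a neutral path, to a reflexivity path with equal canonical ends, or to a `univ`
-- whose two proofs are computable.
--
-- At a function type a path is computable if it has a good head and sends computable paths to
-- computable paths. For a term `M` it is not enough to preserve computability of arguments: `ref M`
-- and the path `M{}` (`Tm.diag`) must be computable too. The first is the path formed by the rule
-- for `ref`. The second is forced by the reduction of `ref (λx.M)` applied to a path, which sends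
-- every variable other than `x` to its reflexivity; once a substitution `s` has been carried out,
-- these variables contribute the paths `(s n){}` (`Tm.subst_upTm_pathInst`).
--
-- The fundamental theorem is proved first for terms (`Derives.cand_tm`), for substitutions and path
-- substitutions together, and then for all judgements by induction on derivations
-- (`Derives.computable`). Neutral proofs are computable, and so are neutral paths with computable
-- ends. In a context without term variables the identity substitution is therefore computable, and
-- every derivable proof or path has a value. A term variable would break this, since a variable of
-- type `Ω` has no canonical form.
--
-- Finally, subject reduction (`Derives.red_pf`, `Derives.red_path`) types the value, and inversion,
-- with injectivity of `⊃`, turns this typing into the stated conversions and typings of components.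

@[simp] theorem cons_zero {α : Type} (a : α) (f : ℕ → α) : cons a f 0 = a := rfl

@[simp] theorem cons_succ {α : Type} (a : α) (f : ℕ → α) (n : ℕ) : cons a f (n + 1) = f n := rfl

theorem comp_cons {α β : Type} (g : α → β) (a : α) (f : ℕ → α) :
    (fun n => g (cons a f n)) = cons (g a) (fun n => g (f n)) := by
  funext n; cases n <;> rfl

theorem cons_congr {α : Type} {a b : α} {f g : ℕ → α} (h : a = b) (h' : ∀ n, f n = g n) :
    cons a f = cons b g := by
  subst h; obtain rfl : f = g := funext h'; rfl

/-! ### Substitution calculus for terms -/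

theorem upTm_comp_upRen (ξ : ℕ → ℕ) (σ : ℕ → Tm) :
    (fun n => upTm σ (upRen ξ n)) = upTm (fun n => σ (ξ n)) := by
  funext n; cases n <;> rfl

theorem upTm_var (ξ : ℕ → ℕ) : upTm (fun n => .var (ξ n)) = fun n => .var (upRen ξ n) := by
  funext n; cases n <;> rfl

theorem upTm_ids : upTm .var = .var := by
  funext n; cases n <;> rfl

namespace Tm

theorem rename_eq_subst (M : Tm) (ξ : ℕ → ℕ) : M.rename ξ = M.subst (fun n => .var (ξ n)) := by
  induction M generalizing ξ with
  | var n => rfl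
  | bot => rfl
  | imp φ ψ ih₁ ih₂ => simp only [rename, subst, ih₁, ih₂]
  | lam A M ih => simp only [rename, subst, ih, upTm_var]
  | app M N ih₁ ih₂ => simp only [rename, subst, ih₁, ih₂]

theorem subst_rename (M : Tm) (ξ : ℕ → ℕ) (σ : ℕ → Tm) :
    (M.rename ξ).subst σ = M.subst (fun n => σ (ξ n)) := by
  induction M generalizing ξ σ with
  | var n => rfl
  | bot => rfl
  | imp φ ψ ih₁ ih₂ => simp only [rename, subst, ih₁, ih₂]
  | lam A M ih => simp only [rename, subst, ih, upTm_comp_upRen]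
  | app M N ih₁ ih₂ => simp only [rename, subst, ih₁, ih₂]

theorem rename_rename (M : Tm) (ξ ξ' : ℕ → ℕ) :
    (M.rename ξ).rename ξ' = M.rename (fun n => ξ' (ξ n)) := by
  rw [rename_eq_subst _ ξ', subst_rename, ← rename_eq_subst]

end Tm

theorem rename_upTm (σ : ℕ → Tm) (ξ : ℕ → ℕ) :
    (fun n => (upTm σ n).rename (upRen ξ)) = upTm (fun n => (σ n).rename ξ) := by
  funext n
  cases n with
  | zero => rfl
  | succ n => simp only [upTm, cons_succ, Tm.shift, Tm.rename_rename]; rfl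

namespace Tm

theorem rename_subst (M : Tm) (σ : ℕ → Tm) (ξ : ℕ → ℕ) :
    (M.subst σ).rename ξ = M.subst (fun n => (σ n).rename ξ) := by
  induction M generalizing ξ σ with
  | var n => rfl
  | bot => rfl
  | imp φ ψ ih₁ ih₂ => simp only [rename, subst, ih₁, ih₂]
  | lam A M ih => simp only [rename, subst, ih, rename_upTm]
  | app M N ih₁ ih₂ => simp only [rename, subst, ih₁, ih₂]

end Tm

/-- Lifting under a binder shifts the values of a substitution, so composing lifted substitutions
requires both mixed laws for a renaming and a substitution. This is why renamings are treated before
substitutions, here and for proofs and paths. -/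
theorem subst_upTm (σ τ : ℕ → Tm) :
    (fun n => (upTm σ n).subst (upTm τ)) = upTm (fun n => (σ n).subst τ) := by
  funext n
  cases n with
  | zero => rfl
  | succ n => simp only [upTm, cons_succ, Tm.shift, Tm.subst_rename, Tm.rename_subst]

namespace Tm

theorem subst_subst (M : Tm) (σ τ : ℕ → Tm) :
    (M.subst σ).subst τ = M.subst (fun n => (σ n).subst τ) := by
  induction M generalizing σ τ with
  | var n => rfl
  | bot => rfl
  | imp φ ψ ih₁ ih₂ => simp only [subst, ih₁, ih₂]
  | lam A M ih => simp only [subst, ih, subst_upTm]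
  | app M N ih₁ ih₂ => simp only [subst, ih₁, ih₂]

@[simp] theorem subst_var (M : Tm) : M.subst .var = M := by
  induction M with
  | var n => rfl
  | bot => rfl
  | imp φ ψ ih₁ ih₂ => simp only [subst, ih₁, ih₂]
  | lam A M ih => simp only [subst, upTm_ids, ih]
  | app M N ih₁ ih₂ => simp only [subst, ih₁, ih₂]

@[simp] theorem rename_id (M : Tm) : M.rename id = M := by
  rw [rename_eq_subst]; exact subst_var M

theorem subst_upTm_inst (M N : Tm) (σ : ℕ → Tm) :
    (M.subst (upTm σ)).inst N = M.subst (cons N σ) := by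
  rw [inst, subst_subst]
  congr 1
  funext n
  cases n with
  | zero => rfl
  | succ n => simp only [upTm, cons_succ, shift, subst_rename]; exact subst_var _

theorem subst_inst (M N : Tm) (σ : ℕ → Tm) :
    (M.inst N).subst σ = (M.subst (upTm σ)).inst (N.subst σ) := by
  rw [subst_upTm_inst, inst, subst_subst]
  congr 1
  funext n
  cases n <;> rfl

@[simp] theorem shift2_subst_cons_cons (M N N' : Tm) (σ : ℕ → Tm) :
    M.shift2.subst (cons N (cons N' σ)) = M.subst σ := by
  rw [shift2, subst_rename]; rfl

end Tm

/-! ### Substitution calculus for proofs and paths -/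

mutual

theorem Prf.rename_eq_subst : ∀ (δ : Prf) (ξ ζ η : ℕ → ℕ), δ.rename ξ ζ η =
    δ.subst (fun n => .var (ξ n)) (fun n => .var (ζ n)) (fun n => .var (η n))
  | .var n, _, _, _ => rfl
  | .lam φ δ, ξ, ζ, η => by
    simp only [Prf.rename, Prf.subst, Tm.rename_eq_subst, Prf.rename_eq_subst δ]
    congr 2
    funext n; cases n <;> rfl
  | .app δ ε, ξ, ζ, η => by
    simp only [Prf.rename, Prf.subst, Prf.rename_eq_subst δ, Prf.rename_eq_subst ε]
  | .plus P, ξ, ζ, η => by simp only [Prf.rename, Prf.subst, Pth.rename_eq_subst P]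
  | .minus P, ξ, ζ, η => by simp only [Prf.rename, Prf.subst, Pth.rename_eq_subst P]

theorem Pth.rename_eq_subst : ∀ (P : Pth) (ξ ζ η : ℕ → ℕ), P.rename ξ ζ η =
    P.subst (fun n => .var (ξ n)) (fun n => .var (ζ n)) (fun n => .var (η n))
  | .var n, _, _, _ => rfl
  | .ref M, ξ, ζ, η => by simp only [Pth.rename, Pth.subst, Tm.rename_eq_subst]
  | .impStar P Q, ξ, ζ, η => by
    simp only [Pth.rename, Pth.subst, Pth.rename_eq_subst P, Pth.rename_eq_subst Q]
  | .univ φ ψ δ ε, ξ, ζ, η => by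
    simp only [Pth.rename, Pth.subst, Tm.rename_eq_subst, Prf.rename_eq_subst δ,
      Prf.rename_eq_subst ε]
  | .lll A P, ξ, ζ, η => by
    simp only [Pth.rename, Pth.subst, Pth.rename_eq_subst P, upTm_var]
    congr 2
    funext n; cases n <;> rfl
  | .app P M N Q, ξ, ζ, η => by
    simp only [Pth.rename, Pth.subst, Tm.rename_eq_subst, Pth.rename_eq_subst P,
      Pth.rename_eq_subst Q]

end

mutual

theorem Prf.subst_rename : ∀ (δ : Prf) (ξ ζ η : ℕ → ℕ) (σ : ℕ → Tm) (π : ℕ → Prf) (κ : ℕ → Pth),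
    (δ.rename ξ ζ η).subst σ π κ =
      δ.subst (fun n => σ (ξ n)) (fun n => π (ζ n)) (fun n => κ (η n))
  | .var n, _, _, _, _, _, _ => rfl
  | .lam φ δ, ξ, ζ, η, σ, π, κ => by
    simp only [Prf.rename, Prf.subst, Tm.subst_rename, Prf.subst_rename δ]
    congr 2
    funext n; cases n <;> rfl
  | .app δ ε, ξ, ζ, η, σ, π, κ => by
    simp only [Prf.rename, Prf.subst, Prf.subst_rename δ, Prf.subst_rename ε]
  | .plus P, ξ, ζ, η, σ, π, κ => by simp only [Prf.rename, Prf.subst, Pth.subst_rename P]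
  | .minus P, ξ, ζ, η, σ, π, κ => by simp only [Prf.rename, Prf.subst, Pth.subst_rename P]

theorem Pth.subst_rename : ∀ (P : Pth) (ξ ζ η : ℕ → ℕ) (σ : ℕ → Tm) (π : ℕ → Prf) (κ : ℕ → Pth),
    (P.rename ξ ζ η).subst σ π κ =
      P.subst (fun n => σ (ξ n)) (fun n => π (ζ n)) (fun n => κ (η n))
  | .var n, _, _, _, _, _, _ => rfl
  | .ref M, ξ, ζ, η, σ, π, κ => by simp only [Pth.rename, Pth.subst, Tm.subst_rename]
  | .impStar P Q, ξ, ζ, η, σ, π, κ => by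
    simp only [Pth.rename, Pth.subst, Pth.subst_rename P, Pth.subst_rename Q]
  | .univ φ ψ δ ε, ξ, ζ, η, σ, π, κ => by
    simp only [Pth.rename, Pth.subst, Tm.subst_rename, Prf.subst_rename δ, Prf.subst_rename ε]
  | .lll A P, ξ, ζ, η, σ, π, κ => by
    simp only [Pth.rename, Pth.subst, Pth.subst_rename P, upTm_comp_upRen]
    congr 2
    funext n; cases n <;> rfl
  | .app P M N Q, ξ, ζ, η, σ, π, κ => by
    simp only [Pth.rename, Pth.subst, Tm.subst_rename, Pth.subst_rename P, Pth.subst_rename Q]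

end

theorem Prf.rename_rename (δ : Prf) (ξ ζ η ξ' ζ' η' : ℕ → ℕ) :
    (δ.rename ξ ζ η).rename ξ' ζ' η' =
      δ.rename (fun n => ξ' (ξ n)) (fun n => ζ' (ζ n)) (fun n => η' (η n)) := by
  rw [Prf.rename_eq_subst _ ξ', Prf.subst_rename, ← Prf.rename_eq_subst]

theorem Pth.rename_rename (P : Pth) (ξ ζ η ξ' ζ' η' : ℕ → ℕ) :
    (P.rename ξ ζ η).rename ξ' ζ' η' =
      P.rename (fun n => ξ' (ξ n)) (fun n => ζ' (ζ n)) (fun n => η' (η n)) := by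
  rw [Pth.rename_eq_subst _ ξ', Pth.subst_rename, ← Pth.rename_eq_subst]

mutual

theorem Prf.rename_subst : ∀ (δ : Prf) (σ : ℕ → Tm) (π : ℕ → Prf) (κ : ℕ → Pth) (ξ ζ η : ℕ → ℕ),
    (δ.subst σ π κ).rename ξ ζ η =
      δ.subst (fun n => (σ n).rename ξ) (fun n => (π n).rename ξ ζ η)
        (fun n => (κ n).rename ξ ζ η)
  | .var n, _, _, _, _, _, _ => rfl
  | .lam φ δ, σ, π, κ, ξ, ζ, η => by
    simp only [Prf.rename, Prf.subst, Tm.rename_subst, Prf.rename_subst δ]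
    congr 2
    · funext n
      cases n with
      | zero => rfl
      | succ n => simp only [cons_succ, Prf.shiftP, Prf.rename_rename]; rfl
    · funext n; simp only [Pth.shiftP, Pth.rename_rename]; rfl
  | .app δ ε, σ, π, κ, ξ, ζ, η => by
    simp only [Prf.rename, Prf.subst, Prf.rename_subst δ, Prf.rename_subst ε]
  | .plus P, σ, π, κ, ξ, ζ, η => by simp only [Prf.rename, Prf.subst, Pth.rename_subst P]
  | .minus P, σ, π, κ, ξ, ζ, η => by simp only [Prf.rename, Prf.subst, Pth.rename_subst P]

theorem Pth.rename_subst : ∀ (P : Pth) (σ : ℕ → Tm) (π : ℕ → Prf) (κ : ℕ → Pth) (ξ ζ η : ℕ → ℕ),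
    (P.subst σ π κ).rename ξ ζ η =
      P.subst (fun n => (σ n).rename ξ) (fun n => (π n).rename ξ ζ η)
        (fun n => (κ n).rename ξ ζ η)
  | .var n, _, _, _, _, _, _ => rfl
  | .ref M, σ, π, κ, ξ, ζ, η => by simp only [Pth.rename, Pth.subst, Tm.rename_subst]
  | .impStar P Q, σ, π, κ, ξ, ζ, η => by
    simp only [Pth.rename, Pth.subst, Pth.rename_subst P, Pth.rename_subst Q]
  | .univ φ ψ δ ε, σ, π, κ, ξ, ζ, η => by
    simp only [Pth.rename, Pth.subst, Tm.rename_subst, Prf.rename_subst δ, Prf.rename_subst ε]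
  | .lll A P, σ, π, κ, ξ, ζ, η => by
    simp only [Pth.rename, Pth.subst, Pth.rename_subst P, rename_upTm]
    congr 2
    · funext n; simp only [Prf.shiftL, Prf.rename_rename]; rfl
    · funext n
      cases n with
      | zero => rfl
      | succ n => simp only [cons_succ, Pth.shiftL, Pth.rename_rename]; rfl
  | .app P M N Q, σ, π, κ, ξ, ζ, η => by
    simp only [Pth.rename, Pth.subst, Tm.rename_subst, Pth.rename_subst P, Pth.rename_subst Q]

end

mutual

theorem Prf.subst_subst : ∀ (δ : Prf) (σ σ' : ℕ → Tm) (π π' : ℕ → Prf) (κ κ' : ℕ → Pth),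
    (δ.subst σ π κ).subst σ' π' κ' =
      δ.subst (fun n => (σ n).subst σ') (fun n => (π n).subst σ' π' κ')
        (fun n => (κ n).subst σ' π' κ')
  | .var n, _, _, _, _, _, _ => rfl
  | .lam φ δ, σ, σ', π, π', κ, κ' => by
    simp only [Prf.subst, Tm.subst_subst, Prf.subst_subst δ]
    congr 2
    · funext n
      cases n with
      | zero => rfl
      | succ n => simp only [cons_succ, Prf.shiftP, Prf.subst_rename, Prf.rename_subst,
          Tm.rename_id, id, Pth.shiftP]
    · funext n
      simp only [Prf.shiftP, Pth.subst_rename, Pth.rename_subst, Tm.rename_id, id, Pth.shiftP,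
        cons_succ]
  | .app δ ε, σ, σ', π, π', κ, κ' => by
    simp only [Prf.subst, Prf.subst_subst δ, Prf.subst_subst ε]
  | .plus P, σ, σ', π, π', κ, κ' => by simp only [Prf.subst, Pth.subst_subst P]
  | .minus P, σ, σ', π, π', κ, κ' => by simp only [Prf.subst, Pth.subst_subst P]

theorem Pth.subst_subst : ∀ (P : Pth) (σ σ' : ℕ → Tm) (π π' : ℕ → Prf) (κ κ' : ℕ → Pth),
    (P.subst σ π κ).subst σ' π' κ' =
      P.subst (fun n => (σ n).subst σ') (fun n => (π n).subst σ' π' κ')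
        (fun n => (κ n).subst σ' π' κ')
  | .var n, _, _, _, _, _, _ => rfl
  | .ref M, σ, σ', π, π', κ, κ' => by simp only [Pth.subst, Tm.subst_subst]
  | .impStar P Q, σ, σ', π, π', κ, κ' => by
    simp only [Pth.subst, Pth.subst_subst P, Pth.subst_subst Q]
  | .univ φ ψ δ ε, σ, σ', π, π', κ, κ' => by
    simp only [Pth.subst, Tm.subst_subst, Prf.subst_subst δ, Prf.subst_subst ε]
  | .lll A P, σ, σ', π, π', κ, κ' => by
    simp only [Pth.subst, Pth.subst_subst P, subst_upTm]
    have h : ∀ n, upTm (upTm σ') (n + 2) = (σ' n).rename (fun n => n + 2) := fun n => by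
      simp only [upTm, cons_succ, Tm.shift, Tm.rename_rename]
    congr 2
    · funext n
      simp only [Prf.shiftL, Prf.subst_rename, Prf.rename_subst, id, Pth.shiftL, h, cons_succ]
    · funext n
      cases n with
      | zero => rfl
      | succ n =>
        simp only [cons_succ, Prf.shiftL, Pth.subst_rename, Pth.rename_subst, id, Pth.shiftL, h]
  | .app P M N Q, σ, σ', π, π', κ, κ' => by
    simp only [Pth.subst, Tm.subst_subst, Pth.subst_subst P, Pth.subst_subst Q]

end

mutual

theorem Prf.subst_var : ∀ δ : Prf, δ.subst .var .var .var = δ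
  | .var n => rfl
  | .lam φ δ => by
    have h : (cons (.var 0) fun n => (Prf.var n).shiftP) = Prf.var := by
      funext n; cases n <;> rfl
    simp only [Prf.subst, Tm.subst_var, h]
    congr 1
    exact Prf.subst_var δ
  | .app δ ε => by simp only [Prf.subst, Prf.subst_var δ, Prf.subst_var ε]
  | .plus P => by simp only [Prf.subst, Pth.subst_var P]
  | .minus P => by simp only [Prf.subst, Pth.subst_var P]

theorem Pth.subst_var : ∀ P : Pth, P.subst .var .var .var = P
  | .var n => rfl
  | .ref M => by simp only [Pth.subst, Tm.subst_var]
  | .impStar P Q => by simp only [Pth.subst, Pth.subst_var P, Pth.subst_var Q]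
  | .univ φ ψ δ ε => by
    simp only [Pth.subst, Tm.subst_var, Prf.subst_var δ, Prf.subst_var ε]
  | .lll A P => by
    have h : (cons (.var 0) fun n => (Pth.var n).shiftL) = Pth.var := by
      funext n; cases n <;> rfl
    simp only [Pth.subst, upTm_ids, h]
    congr 1
    exact Pth.subst_var P
  | .app P M N Q => by
    simp only [Pth.subst, Tm.subst_var, Pth.subst_var P, Pth.subst_var Q]

end

theorem Prf.subst_up_inst (δ ε : Prf) (σ : ℕ → Tm) (π : ℕ → Prf) (κ : ℕ → Pth) :
    (δ.subst σ (cons (.var 0) fun n => (π n).shiftP) (fun n => (κ n).shiftP)).inst ε =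
      δ.subst σ (cons ε π) κ := by
  rw [Prf.inst, Prf.subst_subst]
  congr 1
  · funext n; exact Tm.subst_var _
  · funext n
    cases n with
    | zero => rfl
    | succ n => simp only [cons_succ, Prf.shiftP, Prf.subst_rename]; exact Prf.subst_var _
  · funext n; simp only [Pth.shiftP, Pth.subst_rename]; exact Pth.subst_var _

theorem Pth.subst_up_inst (P Q : Pth) (M N : Tm) (σ : ℕ → Tm) (π : ℕ → Prf) (κ : ℕ → Pth) :
    (P.subst (upTm (upTm σ)) (fun n => (π n).shiftL)
      (cons (.var 0) fun n => (κ n).shiftL)).inst M N Q =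
      P.subst (cons N (cons M σ)) π (cons Q κ) := by
  rw [Pth.inst, Pth.subst_subst]
  congr 1
  · funext n
    rcases n with _ | _ | n
    · rfl
    · rfl
    · simp only [upTm, cons_succ, Tm.shift, Tm.subst_rename]; exact Tm.subst_var _
  · funext n; simp only [Prf.shiftL, Prf.subst_rename]; exact Prf.subst_var _
  · funext n
    cases n with
    | zero => rfl
    | succ n => simp only [cons_succ, Pth.shiftL, Pth.subst_rename]; exact Pth.subst_var _

/-! ### Path substitution -/

namespace Tm

theorem pathSubst_rename (M : Tm) (ξ : ℕ → ℕ) (τ : ℕ → Pth) (ρ σ : ℕ → Tm) :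
    (M.rename ξ).pathSubst τ ρ σ =
      M.pathSubst (fun n => τ (ξ n)) (fun n => ρ (ξ n)) (fun n => σ (ξ n)) := by
  induction M generalizing ξ τ ρ σ with
  | var n => rfl
  | bot => rfl
  | imp φ ψ ih₁ ih₂ => simp only [rename, pathSubst, ih₁, ih₂]
  | lam A M ih =>
    simp only [rename, pathSubst, ih]
    congr 2 <;> (funext n; cases n <;> rfl)
  | app M N ih₁ ih₂ => simp only [rename, pathSubst, ih₁, ih₂, subst_rename]

/-- A term contains no proof or path variables, so `π` and `κ` can act only through the values of
`τ`. -/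
theorem subst_pathSubst (M : Tm) (τ : ℕ → Pth) (ρ σ : ℕ → Tm) (s : ℕ → Tm) (π : ℕ → Prf)
    (κ : ℕ → Pth) :
    (M.pathSubst τ ρ σ).subst s π κ = M.pathSubst (fun n => (τ n).subst s π κ)
      (fun n => (ρ n).subst s) (fun n => (σ n).subst s) := by
  induction M generalizing τ ρ σ s π κ with
  | var n => rfl
  | bot => rfl
  | imp φ ψ ih₁ ih₂ => simp only [pathSubst, Pth.subst, ih₁, ih₂]
  | lam A M ih =>
    simp only [pathSubst, Pth.subst, ih]
    have h : ∀ n, upTm (upTm s) (n + 2) = (s n).rename (fun n => n + 2) := fun n => by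
      simp only [upTm, cons_succ, Tm.shift, Tm.rename_rename]
    congr 2
    · funext n
      cases n with
      | zero => rfl
      | succ n =>
        simp only [cons_succ, Prf.shiftL, Pth.subst_rename, Pth.rename_subst, id, Pth.shiftL, h]
    · funext n
      cases n with
      | zero => rfl
      | succ n => simp only [cons_succ, shift2, subst_rename, rename_subst, h]
    · funext n
      cases n with
      | zero => rfl
      | succ n => simp only [cons_succ, shift2, subst_rename, rename_subst, h]
  | app M N ih₁ ih₂ => simp only [pathSubst, Pth.subst, ih₁, ih₂, subst_subst]

theorem rename_pathSubst (M : Tm) (τ : ℕ → Pth) (ρ σ : ℕ → Tm) (ξ ζ η : ℕ → ℕ) :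
    (M.pathSubst τ ρ σ).rename ξ ζ η = M.pathSubst (fun n => (τ n).rename ξ ζ η)
      (fun n => (ρ n).rename ξ) (fun n => (σ n).rename ξ) := by
  simp only [Pth.rename_eq_subst, Tm.rename_eq_subst, subst_pathSubst]

/-- A variable replaced by `s n` contributes the path `(s n){τ : ρ = σ}`, whose ends are the two
instances of `s n`. This is what lets a `β`-step on terms be mirrored by one on paths. -/
theorem pathSubst_subst (M : Tm) (s : ℕ → Tm) (τ : ℕ → Pth) (ρ σ : ℕ → Tm) :
    (M.subst s).pathSubst τ ρ σ = M.pathSubst (fun n => (s n).pathSubst τ ρ σ)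
      (fun n => (s n).subst ρ) (fun n => (s n).subst σ) := by
  induction M generalizing s τ ρ σ with
  | var n => rfl
  | bot => rfl
  | imp φ ψ ih₁ ih₂ => simp only [subst, pathSubst, ih₁, ih₂]
  | lam A M ih =>
    simp only [subst, pathSubst, ih]
    congr 2
    · funext n
      cases n with
      | zero => rfl
      | succ n =>
        simp only [upTm, cons_succ, shift, pathSubst_rename, Pth.shiftL, rename_pathSubst, shift2]
    · funext n
      cases n with
      | zero => rfl
      | succ n => simp only [upTm, cons_succ, shift, subst_rename, rename_subst, shift2]
    · funext n
      cases n with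
      | zero => rfl
      | succ n => simp only [upTm, cons_succ, shift, subst_rename, rename_subst, shift2]
  | app M N ih₁ ih₂ => simp only [subst, pathSubst, ih₁, ih₂, subst_subst]

theorem pathSubst_up_inst (M : Tm) (τ : ℕ → Pth) (ρ σ : ℕ → Tm) (N N' : Tm) (P : Pth) :
    (M.pathSubst (cons (.var 0) (fun n => (τ n).shiftL)) (cons (.var 1) (fun n => (ρ n).shift2))
      (cons (.var 0) (fun n => (σ n).shift2))).inst N N' P =
      M.pathSubst (cons P τ) (cons N ρ) (cons N' σ) := by
  rw [Pth.inst, subst_pathSubst]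
  congr 1
  · funext n
    cases n with
    | zero => rfl
    | succ n => simp only [cons_succ, Pth.shiftL, Pth.subst_rename]; exact Pth.subst_var _
  · funext n
    cases n with
    | zero => rfl
    | succ n => simp only [cons_succ, shift2_subst_cons_cons]; exact subst_var _
  · funext n
    cases n with
    | zero => rfl
    | succ n => simp only [cons_succ, shift2_subst_cons_cons]; exact subst_var _

/-- The path substitution `M{}` of no variable at all. -/
def diag (M : Tm) : Pth := M.pathSubst (fun n => .ref (.var n)) .var .var

theorem diag_subst (M : Tm) (s : ℕ → Tm) :
    (M.subst s).diag = M.pathSubst (fun n => (s n).diag) s s := by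
  rw [diag, pathSubst_subst]
  simp only [subst_var]; rfl

/-- Computes the contractum of `ref ((λx.M)[s])` applied to `P`. The reflexivities given to the
variables in the values of `s` assemble into the paths `(s n){}`, which is why computable terms are
required to have computable `diag`. -/
theorem subst_upTm_pathInst (M : Tm) (s : ℕ → Tm) (P : Pth) (N N' : Tm) :
    (M.subst (upTm s)).pathInst P N N' =
      M.pathSubst (cons P (fun n => (s n).diag)) (cons N s) (cons N' s) := by
  rw [pathInst, pathSubst_subst]
  congr 1
  · funext n
    cases n with
    | zero => rfl
    | succ n => simp only [upTm, cons_succ, shift, pathSubst_rename]; rfl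
  · funext n
    cases n with
    | zero => rfl
    | succ n => simp only [upTm, cons_succ, shift, subst_rename]; exact subst_var _
  · funext n
    cases n with
    | zero => rfl
    | succ n => simp only [upTm, cons_succ, shift, subst_rename]; exact subst_var _

end Tm

/-- Multi-step reduction of terms. -/
def TmReduces : Tm → Tm → Prop := ReflTransGen TmRed

theorem reflTransGen_map {α β : Type} {r : α → α → Prop} {s : β → β → Prop} (f : α → β)
    (hf : ∀ a b, r a b → s (f a) (f b)) {a b : α} (h : ReflTransGen r a b) :
    ReflTransGen s (f a) (f b) := by
  induction h with
  | refl => exact .refl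
  | tail _ h ih => exact ih.tail (hf _ _ h)

/-! ### Reduction and convertibility of terms -/

theorem TmRed.subst {M N : Tm} (h : TmRed M N) (σ : ℕ → Tm) : TmRed (M.subst σ) (N.subst σ) := by
  induction h with
  | beta A M N => rw [Tm.subst_inst]; exact .beta A _ _
  | app N _ ih => exact .app _ ih
  | impL ψ _ ih => exact .impL _ ih
  | impR φ _ ih => exact .impR _ ih

/-- A redex `(λx.M)N` becomes a triple lambda applied to the path of `N`, and contracting it gives
exactly the path of `M[x := N]`. The congruence rules for terms have counterparts for paths, so one
step is mapped to one step. -/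
theorem TmRed.pathSubst {M N : Tm} (h : TmRed M N) (τ : ℕ → Pth) (ρ σ : ℕ → Tm) :
    PthRed (M.pathSubst τ ρ σ) (N.pathSubst τ ρ σ) := by
  induction h with
  | beta A M N =>
    have h := PthRed.beta A (M.pathSubst (cons (.var 0) (fun n => (τ n).shiftL))
      (cons (.var 1) (fun n => (ρ n).shift2)) (cons (.var 0) (fun n => (σ n).shift2)))
      (N.subst ρ) (N.subst σ) (N.pathSubst τ ρ σ)
    rw [Tm.pathSubst_up_inst] at h
    rw [Tm.inst, Tm.pathSubst_subst]
    have e : ∀ {α : Type} (f : Tm → α) (g : ℕ → α), (∀ n, f (.var n) = g n) →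
        (fun n => f (cons N Tm.var n)) = cons (f N) g := fun f g hg => by
      rw [comp_cons]; exact cons_congr rfl hg
    rw [e (fun t => t.pathSubst τ ρ σ) τ (fun _ => rfl), e (fun t => t.subst ρ) ρ (fun _ => rfl),
      e (fun t => t.subst σ) σ (fun _ => rfl)]
    exact h
  | app N _ ih => exact .app _ _ _ ih
  | impL ψ _ ih => exact .impStarL _ ih
  | impR φ _ ih => exact .impStarR _ ih

/-- An abstraction does not reduce, so a `β`-redex never overlaps a step in its function part. Only
the two sides of an implication can reduce independently, and those steps commute. -/
theorem TmRed.diamond {M N₁ N₂ : Tm} (h₁ : TmRed M N₁) (h₂ : TmRed M N₂) :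
    N₁ = N₂ ∨ ∃ L, TmRed N₁ L ∧ TmRed N₂ L := by
  induction h₁ generalizing N₂ with
  | beta A M N =>
    cases h₂ with
    | beta => exact .inl rfl
    | app _ h => nomatch h
  | app N h ih =>
    cases h₂ with
    | beta => nomatch h
    | app _ h' =>
      rcases ih h' with rfl | ⟨L, hl, hr⟩
      · exact .inl rfl
      · exact .inr ⟨_, .app _ hl, .app _ hr⟩
  | impL ψ h ih =>
    cases h₂ with
    | impL _ h' =>
      rcases ih h' with rfl | ⟨L, hl, hr⟩
      · exact .inl rfl
      · exact .inr ⟨_, .impL _ hl, .impL _ hr⟩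
    | impR _ h' => exact .inr ⟨_, .impR _ h', .impL _ h⟩
  | impR φ h ih =>
    cases h₂ with
    | impR _ h' =>
      rcases ih h' with rfl | ⟨L, hl, hr⟩
      · exact .inl rfl
      · exact .inr ⟨_, .impR _ hl, .impR _ hr⟩
    | impL _ h' => exact .inr ⟨_, .impL _ h', .impR _ h⟩

theorem TmReduces.confluent {M N₁ N₂ : Tm} (h₁ : TmReduces M N₁) (h₂ : TmReduces M N₂) :
    Join TmReduces N₁ N₂ := by
  refine church_rosser (fun a b c hab hac => ?_) h₁ h₂
  rcases hab.diamond hac with rfl | ⟨d, hb, hc⟩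
  · exact ⟨b, .refl, .refl⟩
  · exact ⟨d, .single hb, .single hc⟩

namespace TmConv

theorem refl (M : Tm) : TmConv M M := EqvGen.refl M

theorem symm {M N : Tm} (h : TmConv M N) : TmConv N M := EqvGen.symm _ _ h

theorem trans {M N L : Tm} (h : TmConv M N) (h' : TmConv N L) : TmConv M L :=
  EqvGen.trans _ _ _ h h'

theorem of_red {M N : Tm} (h : TmRed M N) : TmConv M N := EqvGen.rel _ _ h

theorem map {f : Tm → Tm} (hf : ∀ M N, TmRed M N → TmRed (f M) (f N)) {M N : Tm}
    (h : TmConv M N) : TmConv (f M) (f N) := by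
  induction h with
  | rel _ _ h => exact of_red (hf _ _ h)
  | refl => exact refl _
  | symm _ _ _ ih => exact ih.symm
  | trans _ _ _ _ _ ih₁ ih₂ => exact ih₁.trans ih₂

theorem subst {M N : Tm} (h : TmConv M N) (σ : ℕ → Tm) : TmConv (M.subst σ) (N.subst σ) :=
  h.map fun _ _ h => h.subst σ

theorem rename {M N : Tm} (h : TmConv M N) (ξ : ℕ → ℕ) : TmConv (M.rename ξ) (N.rename ξ) := by
  simpa only [Tm.rename_eq_subst] using h.subst _

theorem app {M N : Tm} (h : TmConv M N) (L : Tm) : TmConv (.app M L) (.app N L) :=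
  h.map fun _ _ h => .app L h

theorem imp {φ φ' ψ ψ' : Tm} (h : TmConv φ φ') (h' : TmConv ψ ψ') :
    TmConv (.imp φ ψ) (.imp φ' ψ') :=
  (h.map fun _ _ h => .impL ψ h).trans (h'.map fun _ _ h => .impR φ' h)

theorem of_reduces {M N : Tm} (h : TmReduces M N) : TmConv M N := by
  induction h with
  | refl => exact refl _
  | tail _ h ih => exact ih.trans (of_red h)

theorem join {M N : Tm} (h : TmConv M N) : Join TmReduces M N := by
  induction h with
  | rel _ _ h => exact ⟨_, .single h, .refl⟩
  | refl => exact ⟨_, .refl, .refl⟩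
  | symm _ _ _ ih => obtain ⟨L, h, h'⟩ := ih; exact ⟨L, h', h⟩
  | trans _ _ _ _ _ ih₁ ih₂ =>
    obtain ⟨L, h, h₁⟩ := ih₁
    obtain ⟨L', h₂, h'⟩ := ih₂
    obtain ⟨K, hK, hK'⟩ := h₁.confluent h₂
    exact ⟨K, h.trans hK, h'.trans hK'⟩

/-- The `β`-rule under an instantiated abstraction. -/
theorem lam_subst_app (A : Ty) (M N : Tm) (σ : ℕ → Tm) :
    TmConv (.app ((Tm.lam A M).subst σ) N) (M.subst (cons N σ)) := by
  rw [← Tm.subst_upTm_inst]; exact of_red (.beta A _ _)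

end TmConv

theorem TmReduces.imp {φ φ' ψ ψ' : Tm} (h : TmReduces φ φ') (h' : TmReduces ψ ψ') :
    TmReduces (.imp φ ψ) (.imp φ' ψ') :=
  (reflTransGen_map (fun t => Tm.imp t ψ) (fun _ _ h => .impL ψ h) h).trans
    (reflTransGen_map (fun t => Tm.imp φ' t) (fun _ _ h => .impR φ' h) h')

theorem TmReduces.imp_inv {φ ψ χ : Tm} (h : TmReduces (.imp φ ψ) χ) :
    ∃ φ' ψ', χ = .imp φ' ψ' ∧ TmReduces φ φ' ∧ TmReduces ψ ψ' := by
  induction h with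
  | refl => exact ⟨φ, ψ, rfl, .refl, .refl⟩
  | tail _ h ih =>
    obtain ⟨φ', ψ', rfl, h₁, h₂⟩ := ih
    cases h with
    | impL _ h => exact ⟨_, _, rfl, h₁.tail h, h₂⟩
    | impR _ h => exact ⟨_, _, rfl, h₁, h₂.tail h⟩

/-- By confluence the two implications have a common reduct, and a reduct of an implication is an
implication of reducts. -/
theorem TmConv.imp_inj {φ φ' ψ ψ' : Tm} (h : TmConv (.imp φ ψ) (.imp φ' ψ')) :
    TmConv φ φ' ∧ TmConv ψ ψ' := by
  obtain ⟨χ, h₁, h₂⟩ := h.join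
  obtain ⟨a, b, rfl, ha, hb⟩ := h₁.imp_inv
  obtain ⟨a', b', e, ha', hb'⟩ := h₂.imp_inv
  cases e
  exact ⟨(of_reduces ha).trans (of_reduces ha').symm, (of_reduces hb).trans (of_reduces hb').symm⟩

/-! ### Canonical propositions -/

/-- The propositions built from `⊥` and `⊃` only. -/
inductive CProp : Type
  | bot : CProp
  | imp : CProp → CProp → CProp

/-- A canonical proposition as a term. -/
def CProp.toTm : CProp → Tm
  | .bot => .bot
  | .imp θ θ' => .imp θ.toTm θ'.toTm

theorem CProp.toTm_injective : Function.Injective CProp.toTm := by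
  intro θ θ' h
  induction θ generalizing θ' with
  | bot => cases θ' with
    | bot => rfl
    | imp => cases h
  | imp a b iha ihb => cases θ' with
    | bot => cases h
    | imp a' b' =>
      simp only [toTm, Tm.imp.injEq] at h
      rw [iha h.1, ihb h.2]

theorem CProp.not_red (θ : CProp) (M : Tm) : ¬ TmRed θ.toTm M := by
  induction θ generalizing M with
  | bot => intro h; nomatch h
  | imp a b iha ihb =>
    intro h
    cases h with
    | impL _ h => exact iha _ h
    | impR _ h => exact ihb _ h

theorem CProp.eq_of_reduces {θ : CProp} {M : Tm} (h : TmReduces θ.toTm M) : M = θ.toTm := by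
  induction h with
  | refl => rfl
  | tail _ h ih => subst ih; exact absurd h (θ.not_red _)

/-- Canonical propositions are normal, so the common reduct supplied by confluence must be `θ`
itself. -/
theorem TmConv.reduces {M N : Tm} {θ : CProp} (h : TmConv M N) (h' : TmReduces M θ.toTm) :
    TmReduces N θ.toTm := by
  obtain ⟨L, h₁, h₂⟩ := (h.symm.trans (of_reduces h')).join
  rwa [CProp.eq_of_reduces h₂] at h₁

theorem TmReduces.canon_unique {M : Tm} {θ θ' : CProp} (h : TmReduces M θ.toTm)
    (h' : TmReduces M θ'.toTm) : θ = θ' := by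
  obtain ⟨L, h₁, h₂⟩ := h.confluent h'
  exact CProp.toTm_injective ((CProp.eq_of_reduces h₁).symm.trans (CProp.eq_of_reduces h₂))

theorem TmReduces.imp_canon {φ ψ : Tm} {θ : CProp} (h : TmReduces (.imp φ ψ) θ.toTm) :
    ∃ θ₁ θ₂, θ = .imp θ₁ θ₂ ∧ TmReduces φ θ₁.toTm ∧ TmReduces ψ θ₂.toTm := by
  obtain ⟨φ', ψ', e, h₁, h₂⟩ := h.imp_inv
  cases θ with
  | bot => cases e
  | imp θ₁ θ₂ => cases e; exact ⟨θ₁, θ₂, rfl, h₁, h₂⟩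

/-! ### Multi-step reduction of proofs and paths -/

theorem PrfReduces.app {δ δ' : Prf} (h : PrfReduces δ δ') (ε : Prf) :
    PrfReduces (.app δ ε) (.app δ' ε) :=
  reflTransGen_map (fun t => Prf.app t ε) (fun _ _ h => .app ε h) h

theorem PthReduces.plus {P P' : Pth} (h : PthReduces P P') : PrfReduces (.plus P) (.plus P') :=
  reflTransGen_map Prf.plus (fun _ _ h => .plus h) h

theorem PthReduces.minus {P P' : Pth} (h : PthReduces P P') : PrfReduces (.minus P) (.minus P') :=
  reflTransGen_map Prf.minus (fun _ _ h => .minus h) h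

theorem PthReduces.app {P P' : Pth} (h : PthReduces P P') (M N : Tm) (Q : Pth) :
    PthReduces (.app P M N Q) (.app P' M N Q) :=
  reflTransGen_map (fun t => Pth.app t M N Q) (fun _ _ h => .app M N Q h) h

theorem PthReduces.impStar {P P' Q Q' : Pth} (h : PthReduces P P') (h' : PthReduces Q Q') :
    PthReduces (.impStar P Q) (.impStar P' Q') :=
  (reflTransGen_map (fun t => Pth.impStar t Q) (fun _ _ h => .impStarL Q h) h).trans
    (reflTransGen_map (fun t => Pth.impStar P' t) (fun _ _ h => .impStarR P' h) h')

theorem TmReduces.diag {M N : Tm} (h : TmReduces M N) : PthReduces M.diag N.diag :=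
  reflTransGen_map Tm.diag (fun _ _ h => h.pathSubst _ _ _) h

theorem CProp.diag_reduces (θ : CProp) : PthReduces θ.toTm.diag (.ref θ.toTm) := by
  induction θ with
  | bot => exact .refl
  | imp a b iha ihb => exact (iha.impStar ihb).tail (.refRef _ _)

/-! ### Renaming preserves typing -/

/-- The rules for terms are syntax directed, with no conversion rule, so induction on the term
suffices. It is needed ahead of `Derives.valid`: in the case of `λp:φ`, the validity of `Γ, p:φ`
only yields a typing of `φ` over `Γ`. -/
theorem Derives.tm_valid {Γ : Ctx} {M : Tm} {A : Ty} (h : Derives Γ (.tm M A)) :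
    Derives Γ .valid := by
  induction M generalizing Γ A with
  | var n => cases h with | varT h _ => exact h
  | bot => cases h with | bot h => exact h
  | imp φ ψ ih _ => cases h with | imp h _ => exact ih h
  | lam A M ih =>
    cases h with
    | lamT h => cases ih h with | ctxT _ h => exact h
  | app M N ih _ => cases h with | appT h _ => exact ih h

theorem Derives.valid {Γ : Ctx} {J : Judgement} (h : Derives Γ J) : Derives Γ .valid := by
  induction h with
  | ctxNil => exact .ctxNil
  | ctxT A h _ => exact .ctxT A h
  | ctxP h _ => exact .ctxP h
  | ctxE h h' _ _ => exact .ctxE h h'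
  | varT h _ _ => exact h
  | varP h _ _ => exact h
  | varE h _ _ => exact h
  | bot h _ => exact h
  | imp _ _ ih _ => exact ih
  | appT _ _ ih _ => exact ih
  | lamT _ ih => cases ih with | ctxT _ h => exact h
  | appP _ _ ih _ => exact ih
  | lamP _ ih => cases ih with | ctxP h => exact h.tm_valid
  | convP _ _ _ ih _ => exact ih
  | ref _ ih => exact ih
  | impStar _ _ ih _ => exact ih
  | univ _ _ ih _ => exact ih
  | plus _ ih => exact ih
  | minus _ ih => exact ih
  | lll _ _ _ _ ih _ => exact ih
  | appE _ _ _ _ ih _ _ _ => exact ih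
  | convE _ _ _ _ _ ih _ _ => exact ih

theorem Derives.prop_of_pf {Γ : Ctx} {φ : Tm} {J : Judgement} (h : Derives (.pf Γ φ) J) :
    Derives Γ (.tm φ .omega) := by
  cases h.valid with | ctxP h => exact h

theorem Derives.valid_of_path {Γ : Ctx} {M N : Tm} {A : Ty}
    (h : Derives (.path Γ M A N) .valid) : Derives Γ .valid := by
  cases h with | ctxE h _ => exact h.valid

theorem Derives.ext3_valid {Γ : Ctx} (h : Derives Γ .valid) (A : Ty) :
    Derives (Γ.ext3 A) .valid := by
  have h' := Derives.ctxT A (.ctxT A h)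
  exact .ctxE (.varT h' (.tm _ (.here _ _))) (.varT h' (.here _ _))

/-- `ξ` sends the term variables of `Γ` to those of `Δ`. -/
def TmRen (Δ Γ : Ctx) (ξ : ℕ → ℕ) : Prop := ∀ n A, Γ.HasTm n A → Δ.HasTm (ξ n) A

theorem TmRen.up {Δ Γ : Ctx} {ξ : ℕ → ℕ} (h : TmRen Δ Γ ξ) (A : Ty) :
    TmRen (.tm Δ A) (.tm Γ A) (upRen ξ) := by
  intro n B hn
  cases hn with
  | here => exact .here _ _
  | tm _ hn => exact .tm _ (h _ _ hn)

/-- Separated from the general statement, and proved by induction on the term, because the `λp:φ`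
case there needs the typing of `φ`, which is extracted from the validity of a context and so comes
with no induction hypothesis. `Derives.subst_tm` plays the same role for substitution. -/
theorem Derives.rename_tm {Γ Δ : Ctx} {M : Tm} {A : Ty} {ξ : ℕ → ℕ} (h : Derives Γ (.tm M A))
    (hΔ : Derives Δ .valid) (hξ : TmRen Δ Γ ξ) : Derives Δ (.tm (M.rename ξ) A) := by
  induction M generalizing Γ Δ A ξ with
  | var n => cases h with | varT _ hn => exact .varT hΔ (hξ _ _ hn)
  | bot => cases h with | bot h => exact .bot hΔ
  | imp φ ψ ih ih' => cases h with | imp h h' => exact .imp (ih h hΔ hξ) (ih' h' hΔ hξ)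
  | lam A M ih => cases h with | lamT h => exact .lamT (ih h (.ctxT A hΔ) (hξ.up A))
  | app M N ih ih' => cases h with | appT h h' => exact .appT (ih h hΔ hξ) (ih' h' hΔ hξ)

theorem Tm.shift_rename (M : Tm) (ξ : ℕ → ℕ) :
    M.shift.rename (upRen ξ) = (M.rename ξ).shift := by
  simp only [shift, rename_rename]; rfl

theorem Tm.shift2_rename (M : Tm) (ξ : ℕ → ℕ) :
    M.shift2.rename (upRen (upRen ξ)) = (M.rename ξ).shift2 := by
  simp only [shift2, rename_rename]; rfl

theorem Tm.shift2_eq (M : Tm) : M.shift2 = M.shift.shift := by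
  simp only [shift, shift2, rename_rename]

theorem Tm.shift_subst (M : Tm) (σ : ℕ → Tm) : M.shift.subst (upTm σ) = (M.subst σ).shift := by
  simp only [shift, rename_subst, subst_rename]; rfl

theorem Tm.shift2_subst (M : Tm) (σ : ℕ → Tm) :
    M.shift2.subst (upTm (upTm σ)) = (M.subst σ).shift2 := by
  simp only [shift2_eq, shift_subst]

theorem Tm.shift_subst_cons (M N : Tm) (σ : ℕ → Tm) :
    M.shift.subst (PHOML.cons N σ) = M.subst σ := by
  rw [shift, subst_rename]; rfl

/-- A renaming of the variables of `Γ` to variables of `Δ` of the same types. -/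
structure CtxRen (Δ Γ : Ctx) (ξ ζ η : ℕ → ℕ) : Prop where
  tm : TmRen Δ Γ ξ
  pf : ∀ n φ, Γ.HasPf n φ → Δ.HasPf (ζ n) (φ.rename ξ)
  path : ∀ n M A N, Γ.HasPath n M A N → Δ.HasPath (η n) (M.rename ξ) A (N.rename ξ)

namespace CtxRen

variable {Γ Δ : Ctx} {ξ ζ η : ℕ → ℕ}

theorem up_tm (h : CtxRen Δ Γ ξ ζ η) (A : Ty) : CtxRen (.tm Δ A) (.tm Γ A) (upRen ξ) ζ η where
  tm := h.tm.up A
  pf n φ hn := by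
    cases hn with
    | tm _ hn => rw [Tm.shift_rename]; exact .tm _ (h.pf _ _ hn)
  path n M B N hn := by
    cases hn with
    | tm _ hn => simp only [Tm.shift_rename]; exact .tm _ (h.path _ _ _ _ hn)

theorem up_pf (h : CtxRen Δ Γ ξ ζ η) (φ : Tm) :
    CtxRen (.pf Δ (φ.rename ξ)) (.pf Γ φ) ξ (upRen ζ) η where
  tm n A hn := by cases hn with | pf _ hn => exact .pf _ (h.tm _ _ hn)
  pf n ψ hn := by
    cases hn with
    | here => exact .here _ _
    | pf _ hn => exact .pf _ (h.pf _ _ hn)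
  path n M B N hn := by cases hn with | pf _ hn => exact .pf _ (h.path _ _ _ _ hn)

theorem up_path (h : CtxRen Δ Γ ξ ζ η) (M : Tm) (A : Ty) (N : Tm) :
    CtxRen (.path Δ (M.rename ξ) A (N.rename ξ)) (.path Γ M A N) ξ ζ (upRen η) where
  tm n A hn := by cases hn with | path _ _ _ hn => exact .path _ _ _ (h.tm _ _ hn)
  pf n ψ hn := by cases hn with | path _ _ _ hn => exact .path _ _ _ (h.pf _ _ hn)
  path n M B N hn := by
    cases hn with
    | here => exact .here _ _ _ _
    | path _ _ _ hn => exact .path _ _ _ (h.path _ _ _ _ hn)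

theorem up_ext3 (h : CtxRen Δ Γ ξ ζ η) (A : Ty) :
    CtxRen (Δ.ext3 A) (Γ.ext3 A) (upRen (upRen ξ)) ζ (upRen η) :=
  ((h.up_tm A).up_tm A).up_path (.var 1) A (.var 0)

theorem weaken_tm (Γ : Ctx) (A : Ty) : CtxRen (.tm Γ A) Γ (fun n => n + 1) id id where
  tm _ _ h := .tm _ h
  pf _ _ h := .tm _ h
  path _ _ _ _ h := .tm _ h

theorem weaken_pf (Γ : Ctx) (φ : Tm) : CtxRen (.pf Γ φ) Γ id (fun n => n + 1) id where
  tm _ _ h := .pf _ h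
  pf _ _ h := by simpa using h.pf _
  path _ _ _ _ h := by simpa using h.pf _

theorem weaken_ext3 (Γ : Ctx) (A : Ty) :
    CtxRen (Γ.ext3 A) Γ (fun n => n + 2) id (fun n => n + 1) where
  tm _ _ h := .path _ _ _ (.tm _ (.tm _ h))
  pf _ φ h := by
    have := (h.tm A).tm A
    rw [← Tm.shift2_eq] at this
    exact .path _ _ _ this
  path _ _ _ _ h := by
    have := (h.tm A).tm A
    rw [← Tm.shift2_eq, ← Tm.shift2_eq] at this
    exact .path _ _ _ this

end CtxRen

/-- Rename the variables in a judgement. -/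
def Judgement.rename (ξ ζ η : ℕ → ℕ) : Judgement → Judgement
  | .valid => .valid
  | .tm M A => .tm (M.rename ξ) A
  | .pf δ φ => .pf (δ.rename ξ ζ η) (φ.rename ξ)
  | .path P M A N => .path (P.rename ξ ζ η) (M.rename ξ) A (N.rename ξ)

theorem Derives.rename {Γ Δ : Ctx} {J : Judgement} {ξ ζ η : ℕ → ℕ} (h : Derives Γ J)
    (hΔ : Derives Δ .valid) (hr : CtxRen Δ Γ ξ ζ η) : Derives Δ (J.rename ξ ζ η) := by
  induction h generalizing Δ ξ ζ η with
  | ctxNil | ctxT | ctxP | ctxE => exact hΔ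
  | varT _ hn => exact .varT hΔ (hr.tm _ _ hn)
  | varP _ hn => exact .varP hΔ (hr.pf _ _ hn)
  | varE _ hn => exact .varE hΔ (hr.path _ _ _ _ hn)
  | bot => exact .bot hΔ
  | imp _ _ ih ih' => exact .imp (ih hΔ hr) (ih' hΔ hr)
  | appT _ _ ih ih' => exact .appT (ih hΔ hr) (ih' hΔ hr)
  | lamT _ ih => exact .lamT (ih (.ctxT _ hΔ) (hr.up_tm _))
  | appP _ _ ih ih' => exact .appP (ih hΔ hr) (ih' hΔ hr)
  | lamP h ih => exact .lamP (ih (.ctxP (h.prop_of_pf.rename_tm hΔ hr.tm)) (hr.up_pf _))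
  | convP _ _ hc ih ih' => exact .convP (ih hΔ hr) (ih' hΔ hr) (hc.rename ξ)
  | ref _ ih => exact .ref (ih hΔ hr)
  | impStar _ _ ih ih' => exact .impStar (ih hΔ hr) (ih' hΔ hr)
  | univ _ _ ih ih' => exact .univ (ih hΔ hr) (ih' hΔ hr)
  | plus _ ih => exact .plus (ih hΔ hr)
  | minus _ ih => exact .minus (ih hΔ hr)
  | lll _ _ _ ih ih₁ ih₂ =>
    have := ih (hΔ.ext3_valid _) (hr.up_ext3 _)
    simp only [Judgement.rename, Tm.rename, Tm.shift2_rename] at this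
    exact .lll this (ih₁ hΔ hr) (ih₂ hΔ hr)
  | appE _ _ _ _ ih₁ ih₂ ih₃ ih₄ => exact .appE (ih₁ hΔ hr) (ih₂ hΔ hr) (ih₃ hΔ hr) (ih₄ hΔ hr)
  | convE _ _ _ hc hc' ih ih₁ ih₂ =>
    exact .convE (ih hΔ hr) (ih₁ hΔ hr) (ih₂ hΔ hr) (hc.rename ξ) (hc'.rename ξ)

theorem Derives.shift_tm {Γ : Ctx} {M : Tm} {A : Ty} (h : Derives Γ (.tm M A)) (B : Ty) :
    Derives (.tm Γ B) (.tm M.shift A) :=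
  h.rename_tm (.ctxT B h.valid) (CtxRen.weaken_tm Γ B).tm

theorem Derives.shift2_tm {Γ : Ctx} {M : Tm} {A : Ty} (h : Derives Γ (.tm M A)) (B : Ty) :
    Derives (Γ.ext3 B) (.tm M.shift2 A) :=
  h.rename_tm (h.valid.ext3_valid B) (CtxRen.weaken_ext3 Γ B).tm

theorem Derives.weaken_pf_tm {Γ : Ctx} {M φ : Tm} {A : Ty} (h : Derives Γ (.tm M A))
    (hφ : Derives Γ (.tm φ .omega)) : Derives (.pf Γ φ) (.tm M A) := by
  simpa using h.rename_tm (.ctxP hφ) (CtxRen.weaken_pf Γ φ).tm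

theorem Derives.ext3_var_one {Γ : Ctx} (h : Derives Γ .valid) (A : Ty) :
    Derives (Γ.ext3 A) (.tm (.var 1) A) :=
  .varT (h.ext3_valid A) (.path _ _ _ (.tm _ (.here _ _)))

theorem Derives.ext3_var_zero {Γ : Ctx} (h : Derives Γ .valid) (A : Ty) :
    Derives (Γ.ext3 A) (.tm (.var 0) A) :=
  .varT (h.ext3_valid A) (.path _ _ _ (.here _ _))

/-! ### Substitution preserves typing -/

/-- `σ` sends the term variables of `Γ` to terms over `Δ` of the same types. -/
def TmSub (Δ Γ : Ctx) (σ : ℕ → Tm) : Prop := ∀ n A, Γ.HasTm n A → Derives Δ (.tm (σ n) A)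

theorem TmSub.up {Δ Γ : Ctx} {σ : ℕ → Tm} (h : TmSub Δ Γ σ) (hΔ : Derives Δ .valid) (A : Ty) :
    TmSub (.tm Δ A) (.tm Γ A) (upTm σ) := by
  intro n B hn
  cases hn with
  | here => exact .varT (.ctxT A hΔ) (.here _ _)
  | tm _ hn => exact (h _ _ hn).shift_tm A

theorem TmSub.cons {Δ Γ : Ctx} {σ : ℕ → Tm} {A : Ty} {N : Tm} (h : TmSub Δ Γ σ)
    (hN : Derives Δ (.tm N A)) : TmSub Δ (.tm Γ A) (cons N σ) := by
  intro n B hn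
  cases hn with
  | here => exact hN
  | tm _ hn => exact h _ _ hn

theorem TmSub.ids {Γ : Ctx} (h : Derives Γ .valid) : TmSub Γ Γ .var := fun _ _ hn => .varT h hn

theorem Derives.subst_tm {Γ Δ : Ctx} {M : Tm} {A : Ty} {σ : ℕ → Tm} (h : Derives Γ (.tm M A))
    (hΔ : Derives Δ .valid) (hσ : TmSub Δ Γ σ) : Derives Δ (.tm (M.subst σ) A) := by
  induction M generalizing Γ Δ A σ with
  | var n => cases h with | varT _ hn => exact hσ _ _ hn
  | bot => cases h with | bot h => exact .bot hΔ
  | imp φ ψ ih ih' => cases h with | imp h h' => exact .imp (ih h hΔ hσ) (ih' h' hΔ hσ)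
  | lam A M ih => cases h with | lamT h => exact .lamT (ih h (.ctxT A hΔ) (hσ.up hΔ A))
  | app M N ih ih' => cases h with | appT h h' => exact .appT (ih h hΔ hσ) (ih' h' hΔ hσ)

/-- A substitution of expressions over `Δ` for the variables of `Γ`. -/
structure CtxSub (Δ Γ : Ctx) (σ : ℕ → Tm) (π : ℕ → Prf) (κ : ℕ → Pth) : Prop where
  tm : TmSub Δ Γ σ
  pf : ∀ n φ, Γ.HasPf n φ → Derives Δ (.pf (π n) (φ.subst σ))
  path : ∀ n M A N, Γ.HasPath n M A N → Derives Δ (.path (κ n) (M.subst σ) A (N.subst σ))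

namespace CtxSub

variable {Γ Δ : Ctx} {σ : ℕ → Tm} {π : ℕ → Prf} {κ : ℕ → Pth}

theorem cons_tm (h : CtxSub Δ Γ σ π κ) {A : Ty} {N : Tm} (hN : Derives Δ (.tm N A)) :
    CtxSub Δ (.tm Γ A) (cons N σ) π κ where
  tm := h.tm.cons hN
  pf n φ hn := by
    cases hn with
    | tm _ hn => rw [Tm.shift_subst_cons]; exact h.pf _ _ hn
  path n M B N hn := by
    cases hn with
    | tm _ hn => simp only [Tm.shift_subst_cons]; exact h.path _ _ _ _ hn

theorem cons_pf (h : CtxSub Δ Γ σ π κ) {φ : Tm} {δ : Prf} (hδ : Derives Δ (.pf δ (φ.subst σ))) :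
    CtxSub Δ (.pf Γ φ) σ (cons δ π) κ where
  tm n A hn := by cases hn with | pf _ hn => exact h.tm _ _ hn
  pf n φ hn := by
    cases hn with
    | here => exact hδ
    | pf _ hn => exact h.pf _ _ hn
  path n M B N hn := by cases hn with | pf _ hn => exact h.path _ _ _ _ hn

theorem cons_path (h : CtxSub Δ Γ σ π κ) {M N : Tm} {A : Ty} {P : Pth}
    (hP : Derives Δ (.path P (M.subst σ) A (N.subst σ))) :
    CtxSub Δ (.path Γ M A N) σ π (cons P κ) where
  tm n A hn := by cases hn with | path _ _ _ hn => exact h.tm _ _ hn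
  pf n φ hn := by cases hn with | path _ _ _ hn => exact h.pf _ _ hn
  path n M B N hn := by
    cases hn with
    | here => exact hP
    | path _ _ _ hn => exact h.path _ _ _ _ hn

theorem ids (hΓ : Derives Γ .valid) : CtxSub Γ Γ .var .var .var where
  tm := .ids hΓ
  pf n φ hn := by rw [Tm.subst_var]; exact .varP hΓ hn
  path n M A N hn := by simp only [Tm.subst_var]; exact .varE hΓ hn

theorem rename {Θ : Ctx} {ξ ζ η : ℕ → ℕ} (h : CtxSub Δ Γ σ π κ) (hΘ : Derives Θ .valid)
    (hr : CtxRen Θ Δ ξ ζ η) : CtxSub Θ Γ (fun n => (σ n).rename ξ)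
      (fun n => (π n).rename ξ ζ η) (fun n => (κ n).rename ξ ζ η) where
  tm n A hn := (h.tm n A hn).rename hΘ hr
  pf n φ hn := by rw [← Tm.rename_subst]; exact (h.pf n φ hn).rename hΘ hr
  path n M A N hn := by
    rw [← Tm.rename_subst, ← Tm.rename_subst]; exact (h.path n M A N hn).rename hΘ hr

theorem up_pf (h : CtxSub Δ Γ σ π κ) {φ : Tm} (hφ : Derives Δ (.tm (φ.subst σ) .omega)) :
    CtxSub (.pf Δ (φ.subst σ)) (.pf Γ φ) σ (cons (.var 0) fun n => (π n).shiftP)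
      (fun n => (κ n).shiftP) := by
  have := h.rename (.ctxP hφ) (CtxRen.weaken_pf Δ (φ.subst σ))
  simp only [Tm.rename_id] at this
  exact this.cons_pf (.varP (.ctxP hφ) (.here _ _))

theorem up_ext3 (h : CtxSub Δ Γ σ π κ) (hΔ : Derives Δ .valid) (A : Ty) :
    CtxSub (Δ.ext3 A) (Γ.ext3 A) (upTm (upTm σ)) (fun n => (π n).shiftL)
      (cons (.var 0) fun n => (κ n).shiftL) := by
  have := (((h.rename (hΔ.ext3_valid A) (CtxRen.weaken_ext3 Δ A)).cons_tm
    (hΔ.ext3_var_one A)).cons_tm (hΔ.ext3_var_zero A)).cons_path (M := .var 1) (N := .var 0)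
    (.varE (hΔ.ext3_valid A) (.here _ _ _ _))
  -- The twice lifted substitution is an extension of the weakened one by `x` and `y`, so the
  -- extension lemmas already provide its typing.
  have e : upTm (upTm σ) =
      PHOML.cons (.var 0) (PHOML.cons (.var 1) fun n => (σ n).rename fun n => n + 2) := by
    funext n
    rcases n with _ | _ | n
    · rfl
    · rfl
    · exact (Tm.shift2_eq (σ n)).symm
  rw [e]
  exact this

end CtxSub

/-- Substitute for the variables in a judgement. -/
def Judgement.subst (σ : ℕ → Tm) (π : ℕ → Prf) (κ : ℕ → Pth) : Judgement → Judgement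
  | .valid => .valid
  | .tm M A => .tm (M.subst σ) A
  | .pf δ φ => .pf (δ.subst σ π κ) (φ.subst σ)
  | .path P M A N => .path (P.subst σ π κ) (M.subst σ) A (N.subst σ)

theorem Derives.subst {Γ Δ : Ctx} {J : Judgement} {σ : ℕ → Tm} {π : ℕ → Prf} {κ : ℕ → Pth}
    (h : Derives Γ J) (hΔ : Derives Δ .valid) (hs : CtxSub Δ Γ σ π κ) :
    Derives Δ (J.subst σ π κ) := by
  induction h generalizing Δ σ π κ with
  | ctxNil | ctxT | ctxP | ctxE => exact hΔ
  | varT _ hn => exact hs.tm _ _ hn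
  | varP _ hn => exact hs.pf _ _ hn
  | varE _ hn => exact hs.path _ _ _ _ hn
  | bot => exact .bot hΔ
  | imp _ _ ih ih' => exact .imp (ih hΔ hs) (ih' hΔ hs)
  | appT _ _ ih ih' => exact .appT (ih hΔ hs) (ih' hΔ hs)
  -- The statement for terms settles this case, so proofs and paths need not be lifted under a
  -- single term variable.
  | lamT h _ => exact (Derives.lamT h).subst_tm hΔ hs.tm
  | appP _ _ ih ih' => exact .appP (ih hΔ hs) (ih' hΔ hs)
  | lamP h ih =>
    have hφ := h.prop_of_pf.subst_tm hΔ hs.tm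
    exact .lamP (ih (.ctxP hφ) (hs.up_pf hφ))
  | convP _ _ hc ih ih' => exact .convP (ih hΔ hs) (ih' hΔ hs) (hc.subst σ)
  | ref _ ih => exact .ref (ih hΔ hs)
  | impStar _ _ ih ih' => exact .impStar (ih hΔ hs) (ih' hΔ hs)
  | univ _ _ ih ih' => exact .univ (ih hΔ hs) (ih' hΔ hs)
  | plus _ ih => exact .plus (ih hΔ hs)
  | minus _ ih => exact .minus (ih hΔ hs)
  | lll _ _ _ ih ih₁ ih₂ =>
    have := ih (hΔ.ext3_valid _) (hs.up_ext3 hΔ _)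
    simp only [Judgement.subst, Tm.subst, Tm.shift2_subst] at this
    exact .lll this (ih₁ hΔ hs) (ih₂ hΔ hs)
  | appE _ _ _ _ ih₁ ih₂ ih₃ ih₄ => exact .appE (ih₁ hΔ hs) (ih₂ hΔ hs) (ih₃ hΔ hs) (ih₄ hΔ hs)
  | convE _ _ _ hc hc' ih ih₁ ih₂ =>
    exact .convE (ih hΔ hs) (ih₁ hΔ hs) (ih₂ hΔ hs) (hc.subst σ) (hc'.subst σ)

/-- Path substitution preserves typing. -/
theorem Derives.pathSubst {Γ Δ : Ctx} {M : Tm} {A : Ty} {τ : ℕ → Pth} {ρ σ : ℕ → Tm}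
    (h : Derives Γ (.tm M A)) (hΔ : Derives Δ .valid) (hρ : TmSub Δ Γ ρ) (hσ : TmSub Δ Γ σ)
    (hτ : ∀ n B, Γ.HasTm n B → Derives Δ (.path (τ n) (ρ n) B (σ n))) :
    Derives Δ (.path (M.pathSubst τ ρ σ) (M.subst ρ) A (M.subst σ)) := by
  induction M generalizing Γ Δ A τ ρ σ with
  | var n => cases h with | varT _ hn => exact hτ _ _ hn
  | bot => cases h with | bot h => exact .ref (.bot hΔ)
  | imp φ ψ ih ih' =>
    cases h with | imp h h' => exact .impStar (ih h hΔ hρ hσ hτ) (ih' h' hΔ hρ hσ hτ)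
  | app M N ih ih' =>
    cases h with
    | appT h h' =>
      exact .appE (ih h hΔ hρ hσ hτ) (ih' h' hΔ hρ hσ hτ) (h'.subst_tm hΔ hρ) (h'.subst_tm hΔ hσ)
  | lam A M ih =>
    cases h with
    | @lamT _ _ _ B h =>
      have hΔ' := hΔ.ext3_valid A
      have shifted : ∀ {s : ℕ → Tm}, TmSub Δ Γ s → TmSub (Δ.ext3 A) Γ (fun n => (s n).shift2) :=
        fun hs n B hn => (hs n B hn).shift2_tm A
      -- The induction hypothesis types the new body at instances of `M`, whereas the rule for the
      -- triple lambda asks for the abstractions applied to `x` and `y`. The two differ by a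
      -- `β`-step.
      have applied : ∀ {s : ℕ → Tm} {k : ℕ}, TmSub Δ Γ s → Derives (Δ.ext3 A) (.tm (.var k) A) →
          Derives (Δ.ext3 A) (.tm (.app ((Tm.lam A M).subst s).shift2 (.var k)) B) ∧
          TmConv (M.subst (cons (.var k) fun n => (s n).shift2))
            (.app ((Tm.lam A M).subst s).shift2 (.var k)) := by
        intro s k hs hk
        refine ⟨.appT (((Derives.lamT h).subst_tm hΔ hs).shift2_tm A) hk, ?_⟩
        have := (TmConv.lam_subst_app A M (.var k) (fun n => (s n).shift2)).symm
        rwa [show (Tm.lam A M).subst (fun n => (s n).shift2) = ((Tm.lam A M).subst s).shift2 from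
          (Tm.rename_subst ..).symm] at this
      have one := hΔ.ext3_var_one A
      have zero := hΔ.ext3_var_zero A
      refine .lll (.convE (ih h hΔ' ((shifted hρ).cons one) ((shifted hσ).cons zero) ?_)
        (applied hρ one).1 (applied hσ zero).1 (applied hρ one).2 (applied hσ zero).2)
        ((Derives.lamT h).subst_tm hΔ hρ) ((Derives.lamT h).subst_tm hΔ hσ)
      intro n C hn
      cases hn with
      | here => exact .varE hΔ' (.here _ _ _ _)
      | tm _ hn => exact (hτ _ _ hn).rename hΔ' (CtxRen.weaken_ext3 Δ A)

/-! ### Well-formedness of the types of proofs and paths -/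

theorem Derives.of_hasPf {Γ : Ctx} {n : ℕ} {φ : Tm} (hn : Γ.HasPf n φ) (h : Derives Γ .valid) :
    Derives Γ (.tm φ .omega) := by
  induction hn with
  | here Γ φ => cases h with | ctxP h => exact h.weaken_pf_tm h
  | tm B _ ih => cases h with | ctxT _ h => exact (ih h).shift_tm B
  | pf ψ _ ih => cases h with | ctxP h => exact (ih h.valid).weaken_pf_tm h
  | path M B N _ ih =>
    have h₀ := h.valid_of_path
    simpa using (ih h₀).rename_tm (ξ := id) h fun _ _ hn => hn.path M B N

theorem Derives.of_hasPath {Γ : Ctx} {n : ℕ} {M N : Tm} {A : Ty} (hn : Γ.HasPath n M A N)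
    (h : Derives Γ .valid) : Derives Γ (.tm M A) ∧ Derives Γ (.tm N A) := by
  have weaken : ∀ {Γ : Ctx} {M N L : Tm} {A B : Ty}, Derives (.path Γ M A N) .valid →
      Derives Γ (.tm L B) → Derives (.path Γ M A N) (.tm L B) := fun h hL => by
    simpa using hL.rename_tm (ξ := id) h fun _ _ hn => hn.path _ _ _
  induction hn with
  | here Γ M A N => cases h with
    | ctxE h₁ h₂ => exact ⟨weaken (.ctxE h₁ h₂) h₁, weaken (.ctxE h₁ h₂) h₂⟩
  | tm B _ ih => cases h with | ctxT _ h => exact ⟨(ih h).1.shift_tm B, (ih h).2.shift_tm B⟩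
  | pf ψ _ ih =>
    cases h with
    | ctxP h => exact ⟨(ih h.valid).1.weaken_pf_tm h, (ih h.valid).2.weaken_pf_tm h⟩
  | path M B N _ ih =>
    have h₀ := h.valid_of_path
    exact ⟨weaken h (ih h₀).1, weaken h (ih h₀).2⟩

/-- The proposition or the equation of a judgement is well formed. -/
def Judgement.WellFormed (Γ : Ctx) : Judgement → Prop
  | .valid => True
  | .tm _ _ => True
  | .pf _ φ => Derives Γ (.tm φ .omega)
  | .path _ M A N => Derives Γ (.tm M A) ∧ Derives Γ (.tm N A)

theorem Derives.wellFormed {Γ : Ctx} {J : Judgement} (h : Derives Γ J) : J.WellFormed Γ := by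
  induction h with
  | ctxNil | ctxT | ctxP | ctxE | varT | bot | imp | appT | lamT => trivial
  | varP h hn => exact Derives.of_hasPf hn h
  | varE h hn => exact Derives.of_hasPath hn h
  | appP _ _ ih _ => cases ih with | imp _ h => exact h
  | lamP h ih =>
    refine .imp h.prop_of_pf ?_
    -- Terms contain no proof variables, so the assumption `p : φ` can be dropped from the typing of
    -- `ψ`: the identity is a renaming of term variables from `Γ, p:φ` to `Γ`.
    simpa using ih.rename_tm (ξ := id) h.prop_of_pf.valid fun _ _ hn => by
      cases hn with | pf _ hn => exact hn
  | convP _ h _ _ _ => exact h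
  | ref h _ => exact ⟨h, h⟩
  | impStar _ _ ih ih' => exact ⟨.imp ih.1 ih'.1, .imp ih.2 ih'.2⟩
  | univ _ _ ih _ => cases ih with | imp h h' => exact ⟨h, h'⟩
  | plus _ ih => exact .imp ih.1 ih.2
  | minus _ ih => exact .imp ih.2 ih.1
  | lll _ h h' => exact ⟨h, h'⟩
  | appE _ _ h h' ih _ => exact ⟨.appT ih.1 h, .appT ih.2 h'⟩
  | convE _ h h' => exact ⟨h, h'⟩

theorem Derives.pf_wf {Γ : Ctx} {δ : Prf} {φ : Tm} (h : Derives Γ (.pf δ φ)) :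
    Derives Γ (.tm φ .omega) := h.wellFormed

theorem Derives.path_wf {Γ : Ctx} {P : Pth} {M N : Tm} {A : Ty} (h : Derives Γ (.path P M A N)) :
    Derives Γ (.tm M A) ∧ Derives Γ (.tm N A) := h.wellFormed

/-! ### Inversion -/

/-- Only the formation rule of this proof and conversion can end the derivation, so the conversions
accumulate into a single one. The other inversion lemmas follow the same pattern; conversion of
paths never changes the type annotation, so equalities of types come out strict. -/
theorem Derives.lamP_inv {Γ : Ctx} {φ χ : Tm} {δ : Prf} (h : Derives Γ (.pf (.lam φ δ) χ)) :
    ∃ ψ, Derives (.pf Γ φ) (.pf δ ψ) ∧ TmConv (.imp φ ψ) χ := by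
  generalize hJ : Judgement.pf (.lam φ δ) χ = J at h
  induction h generalizing χ with
  | lamP h => cases hJ; exact ⟨_, h, .refl _⟩
  | convP _ _ hc ih => cases hJ; obtain ⟨ψ, h, h'⟩ := ih rfl; exact ⟨ψ, h, h'.trans hc⟩
  | _ => cases hJ

theorem Derives.appP_inv {Γ : Ctx} {χ : Tm} {δ ε : Prf} (h : Derives Γ (.pf (.app δ ε) χ)) :
    ∃ φ ψ, Derives Γ (.pf δ (.imp φ ψ)) ∧ Derives Γ (.pf ε φ) ∧ TmConv ψ χ := by
  generalize hJ : Judgement.pf (.app δ ε) χ = J at h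
  induction h generalizing χ with
  | appP h h' => cases hJ; exact ⟨_, _, h, h', .refl _⟩
  | convP _ _ hc ih =>
    cases hJ; obtain ⟨φ, ψ, h, h', hc'⟩ := ih rfl; exact ⟨φ, ψ, h, h', hc'.trans hc⟩
  | _ => cases hJ

theorem Derives.plus_inv {Γ : Ctx} {χ : Tm} {P : Pth} (h : Derives Γ (.pf (.plus P) χ)) :
    ∃ φ ψ, Derives Γ (.path P φ .omega ψ) ∧ TmConv (.imp φ ψ) χ := by
  generalize hJ : Judgement.pf (.plus P) χ = J at h
  induction h generalizing χ with
  | plus h => cases hJ; exact ⟨_, _, h, .refl _⟩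
  | convP _ _ hc ih => cases hJ; obtain ⟨φ, ψ, h, hc'⟩ := ih rfl; exact ⟨φ, ψ, h, hc'.trans hc⟩
  | _ => cases hJ

theorem Derives.minus_inv {Γ : Ctx} {χ : Tm} {P : Pth} (h : Derives Γ (.pf (.minus P) χ)) :
    ∃ φ ψ, Derives Γ (.path P φ .omega ψ) ∧ TmConv (.imp ψ φ) χ := by
  generalize hJ : Judgement.pf (.minus P) χ = J at h
  induction h generalizing χ with
  | minus h => cases hJ; exact ⟨_, _, h, .refl _⟩
  | convP _ _ hc ih => cases hJ; obtain ⟨φ, ψ, h, hc'⟩ := ih rfl; exact ⟨φ, ψ, h, hc'.trans hc⟩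
  | _ => cases hJ

theorem Derives.ref_inv {Γ : Ctx} {L M N : Tm} {A : Ty} (h : Derives Γ (.path (.ref L) M A N)) :
    Derives Γ (.tm L A) ∧ TmConv L M ∧ TmConv L N := by
  generalize hJ : Judgement.path (.ref L) M A N = J at h
  induction h generalizing M N with
  | ref h => cases hJ; exact ⟨h, .refl _, .refl _⟩
  | convE _ _ _ hc hc' ih =>
    cases hJ; obtain ⟨h, h₁, h₂⟩ := ih rfl; exact ⟨h, h₁.trans hc, h₂.trans hc'⟩
  | _ => cases hJ

theorem Derives.univ_inv {Γ : Ctx} {φ ψ M N : Tm} {δ ε : Prf} {A : Ty}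
    (h : Derives Γ (.path (.univ φ ψ δ ε) M A N)) :
    A = .omega ∧ Derives Γ (.pf δ (.imp φ ψ)) ∧ Derives Γ (.pf ε (.imp ψ φ)) ∧ TmConv φ M ∧
      TmConv ψ N := by
  generalize hJ : Judgement.path (.univ φ ψ δ ε) M A N = J at h
  induction h generalizing M N with
  | univ h h' => cases hJ; exact ⟨rfl, h, h', .refl _, .refl _⟩
  | convE _ _ _ hc hc' ih =>
    cases hJ
    obtain ⟨e, h, h', h₁, h₂⟩ := ih rfl
    exact ⟨e, h, h', h₁.trans hc, h₂.trans hc'⟩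
  | _ => cases hJ

theorem Derives.impStar_inv {Γ : Ctx} {M N : Tm} {P Q : Pth} {A : Ty}
    (h : Derives Γ (.path (.impStar P Q) M A N)) :
    A = .omega ∧ ∃ φ φ' ψ ψ', Derives Γ (.path P φ .omega φ') ∧
      Derives Γ (.path Q ψ .omega ψ') ∧ TmConv (.imp φ ψ) M ∧ TmConv (.imp φ' ψ') N := by
  generalize hJ : Judgement.path (.impStar P Q) M A N = J at h
  induction h generalizing M N with
  | impStar h h' => cases hJ; exact ⟨rfl, _, _, _, _, h, h', .refl _, .refl _⟩
  | convE _ _ _ hc hc' ih =>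
    cases hJ
    obtain ⟨e, _, _, _, _, h, h', h₁, h₂⟩ := ih rfl
    exact ⟨e, _, _, _, _, h, h', h₁.trans hc, h₂.trans hc'⟩
  | _ => cases hJ

theorem Derives.lll_inv {Γ : Ctx} {M N : Tm} {P : Pth} {A C : Ty}
    (h : Derives Γ (.path (.lll A P) M C N)) :
    ∃ B M' N', C = .arrow A B ∧
      Derives (Γ.ext3 A) (.path P (.app M'.shift2 (.var 1)) B (.app N'.shift2 (.var 0))) ∧
      TmConv M' M ∧ TmConv N' N := by
  generalize hJ : Judgement.path (.lll A P) M C N = J at h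
  induction h generalizing M N with
  | lll h => cases hJ; exact ⟨_, _, _, rfl, h, .refl _, .refl _⟩
  | convE _ _ _ hc hc' ih =>
    cases hJ
    obtain ⟨_, _, _, e, h, h₁, h₂⟩ := ih rfl
    exact ⟨_, _, _, e, h, h₁.trans hc, h₂.trans hc'⟩
  | _ => cases hJ

theorem Derives.appE_inv {Γ : Ctx} {L L' N N' : Tm} {P Q : Pth} {B : Ty}
    (h : Derives Γ (.path (.app P N N' Q) L B L')) :
    ∃ A M M', Derives Γ (.path P M (.arrow A B) M') ∧ Derives Γ (.path Q N A N') ∧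
      TmConv (.app M N) L ∧ TmConv (.app M' N') L' := by
  generalize hJ : Judgement.path (.app P N N' Q) L B L' = J at h
  induction h generalizing L L' with
  | appE h h' => cases hJ; exact ⟨_, _, _, h, h', .refl _, .refl _⟩
  | convE _ _ _ hc hc' ih =>
    cases hJ
    obtain ⟨_, _, _, h, h', h₁, h₂⟩ := ih rfl
    exact ⟨_, _, _, h, h', h₁.trans hc, h₂.trans hc'⟩
  | _ => cases hJ

/-- The typing of the body of a triple lambda, at given ends of its equation. -/
theorem Derives.lll_body {Γ : Ctx} {M N : Tm} {P : Pth} {A B : Ty}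
    (h : Derives Γ (.path (.lll A P) M (.arrow A B) N)) :
    Derives (Γ.ext3 A) (.path P (.app M.shift2 (.var 1)) B (.app N.shift2 (.var 0))) := by
  obtain ⟨_, M', N', e, h', h₁, h₂⟩ := h.lll_inv
  cases e
  obtain ⟨hM, hN⟩ := h.path_wf
  exact .convE h' (.appT (hM.shift2_tm A) (h.valid.ext3_var_one A))
    (.appT (hN.shift2_tm A) (h.valid.ext3_var_zero A)) ((h₁.rename _).app _) ((h₂.rename _).app _)

/-- The typing of the body of an abstraction, at a given implication. -/
theorem Derives.lamP_body {Γ : Ctx} {φ φ' ψ : Tm} {δ : Prf}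
    (h : Derives Γ (.pf (.lam φ' δ) (.imp φ ψ))) :
    TmConv φ φ' ∧ Derives (.pf Γ φ) (.pf δ ψ) := by
  obtain ⟨ψ', h', hc⟩ := h.lamP_inv
  obtain ⟨hφ, hψ⟩ := hc.imp_inj
  cases h.pf_wf with
  | imp h₁ h₂ =>
    refine ⟨hφ.symm, .convP ?_ (h₂.weaken_pf_tm h₁) hψ⟩
    have hv := Derives.ctxP h₁
    have hs := (CtxSub.ids h.valid).rename hv (CtxRen.weaken_pf Γ φ)
    -- Replacing the assumption `p : φ'` by `p : φ` is an identity substitution in which `p`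
    -- receives its new type by conversion.
    have := h'.subst hv (hs.cons_pf (δ := .var 0) (.convP (.varP hv (.here _ _)) ?_ ?_))
    · have e : (fun n => (Tm.var n).rename id) = Tm.var := rfl
      have e₁ : (cons (Prf.var 0) fun n => (Prf.var n).rename id (fun n => n + 1) id) = .var := by
        funext n; cases n <;> rfl
      have e₂ : (fun n => (Pth.var n).rename id (fun n => n + 1) id) = Pth.var := rfl
      rw [e, e₁, e₂] at this
      simpa only [Judgement.subst, Tm.subst_var, Prf.subst_var] using this
    · have := h'.prop_of_pf.weaken_pf_tm h₁
      rwa [show (fun n => (Tm.var n).rename id) = Tm.var from rfl, Tm.subst_var]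
    · rw [show (fun n => (Tm.var n).rename id) = Tm.var from rfl, Tm.subst_var]
      exact hφ.symm

/-! ### Subject reduction -/

theorem Derives.red_tm {Γ : Ctx} {M N : Tm} {A : Ty} (h : Derives Γ (.tm M A)) (hr : TmRed M N) :
    Derives Γ (.tm N A) := by
  induction hr generalizing A with
  | beta A M N =>
    cases h with
    | appT h h' =>
      cases h with
      | lamT h => exact h.subst_tm h'.valid ((TmSub.ids h'.valid).cons h')
  | app N _ ih => cases h with | appT h h' => exact .appT (ih h) h'
  | impL ψ _ ih => cases h with | imp h h' => exact .imp (ih h) h'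
  | impR φ _ ih => cases h with | imp h h' => exact .imp h (ih h')

/-- The body is checked over an arbitrary `Δ` that weakens `Γ` by two proof variables, which spares
the reductions of `⊃*` the handling of a concrete extended context. -/
theorem Derives.lam_lam {Γ : Ctx} {φ ψ χ : Tm} {δ : Prf} (hφ : Derives Γ (.tm φ .omega))
    (hψ : Derives Γ (.tm ψ .omega))
    (h : ∀ Δ, CtxRen Δ Γ id (fun n => n + 2) id → Derives Δ .valid → Derives Δ (.pf (.var 1) φ) →
      Derives Δ (.pf (.var 0) ψ) → Derives Δ (.pf δ χ)) :
    Derives Γ (.pf (.lam φ (.lam ψ δ)) (.imp φ (.imp ψ χ))) := by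
  have hv := Derives.ctxP (hψ.weaken_pf_tm hφ)
  refine .lamP (.lamP (h _ ⟨fun _ _ hn => .pf _ (.pf _ hn), fun _ _ hn => ?_,
    fun _ _ _ _ hn => ?_⟩ hv (.varP hv (.pf _ (.here _ _))) (.varP hv (.here _ _))))
  · simpa using (hn.pf _).pf _
  · simpa using (hn.pf _).pf _

theorem Derives.shiftP2 {Γ Δ : Ctx} {φ : Tm} {δ : Prf} (h : Derives Γ (.pf δ φ))
    (hr : CtxRen Δ Γ id (fun n => n + 2) id) (hΔ : Derives Δ .valid) :
    Derives Δ (.pf δ.shiftP2 φ) := by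
  have := h.rename hΔ hr
  rwa [Judgement.rename, Tm.rename_id] at this

theorem Derives.imp_parts {Γ : Ctx} {φ ψ : Tm} {δ : Prf} (h : Derives Γ (.pf δ (.imp φ ψ))) :
    Derives Γ (.tm φ .omega) ∧ Derives Γ (.tm ψ .omega) := by
  cases h.pf_wf with | imp h h' => exact ⟨h, h'⟩

/-- Inversion determines the ends of a path only up to `≃`. The contractum is typed at the ends
found there, and `convE` restores the given ones, which are well formed because the original path
was typed at them. -/
theorem Derives.red_path {Γ : Ctx} {P Q : Pth} {M N : Tm} {A : Ty}
    (h : Derives Γ (.path P M A N)) (hr : PthRed P Q) : Derives Γ (.path Q M A N) := by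
  obtain ⟨hM, hN⟩ := h.path_wf
  have hΓ := h.valid
  induction hr generalizing A M N with
  | beta A P N N' Q =>
    obtain ⟨_, L, L', h₁, h₂, hc, hc'⟩ := h.appE_inv
    obtain ⟨_, _, _, e, -⟩ := h₁.lll_inv
    cases e
    obtain ⟨hN₁, hN₂⟩ := h₂.path_wf
    have hs := ((((CtxSub.ids hΓ).cons_tm hN₁).cons_tm hN₂).cons_path (M := .var 1)
      (N := .var 0) h₂)
    have := h₁.lll_body.subst hΓ hs
    simp only [Judgement.subst, Tm.subst, Tm.shift2_subst_cons_cons, Tm.subst_var] at this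
    exact .convE this hM hN hc hc'
  | refLam A L N₁ N₂ Q =>
    obtain ⟨_, L₁, L₂, h₁, h₂, hc, hc'⟩ := h.appE_inv
    obtain ⟨h₃, hc₁, hc₂⟩ := h₁.ref_inv
    cases h₃ with
    | lamT h₃ =>
      obtain ⟨hN₁, hN₂⟩ := h₂.path_wf
      have hid := TmSub.ids hΓ
      -- The contractum is a path substitution sending the bound variable to `Q` and all others to
      -- their reflexivities; its ends are the `β`-reducts of the two applications.
      refine .convE (h₃.pathSubst hΓ (hid.cons hN₁) (hid.cons hN₂)
        (τ := cons Q fun n => .ref (.var n)) ?_)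
        hM hN (.trans (.symm (.of_red (.beta ..))) ((hc₁.app _).trans hc))
        (.trans (.symm (.of_red (.beta ..))) ((hc₂.app _).trans hc'))
      intro n B hn
      cases hn with
      | here => exact h₂
      | tm _ hn => exact .ref (.varT hΓ hn)
  | refRef φ ψ =>
    obtain ⟨rfl, _, _, _, _, h₁, h₂, hc, hc'⟩ := h.impStar_inv
    obtain ⟨h₃, hc₁, hc₂⟩ := h₁.ref_inv
    obtain ⟨h₄, hc₃, hc₄⟩ := h₂.ref_inv
    exact .convE (.ref (.imp h₃ h₄)) hM hN ((hc₁.imp hc₃).trans hc) ((hc₂.imp hc₄).trans hc')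
  | refUniv φ ψ χ δ ε =>
    obtain ⟨rfl, _, _, _, _, h₁, h₂, hc, hc'⟩ := h.impStar_inv
    obtain ⟨hφ, hc₁, hc₂⟩ := h₁.ref_inv
    obtain ⟨-, hδ, hε, hc₃, hc₄⟩ := h₂.univ_inv
    obtain ⟨hψ, hχ⟩ := hδ.imp_parts
    refine .convE (.univ (.lam_lam (.imp hφ hψ) hφ fun Δ hr hv hp hq => ?_)
      (.lam_lam (.imp hφ hχ) hφ fun Δ hr hv hp hq => ?_)) hM hN
      ((hc₁.imp hc₃).trans hc) ((hc₂.imp hc₄).trans hc')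
    · exact .appP (hδ.shiftP2 hr hv) (.appP hp hq)
    · exact .appP (hε.shiftP2 hr hv) (.appP hp hq)
  | univRef φ ψ χ δ ε =>
    obtain ⟨rfl, _, _, _, _, h₁, h₂, hc, hc'⟩ := h.impStar_inv
    obtain ⟨hχ, hc₁, hc₂⟩ := h₂.ref_inv
    obtain ⟨-, hδ, hε, hc₃, hc₄⟩ := h₁.univ_inv
    obtain ⟨hφ, hψ⟩ := hδ.imp_parts
    refine .convE (.univ (.lam_lam (.imp hφ hχ) hψ fun Δ hr hv hp hq => ?_)
      (.lam_lam (.imp hψ hχ) hφ fun Δ hr hv hp hq => ?_)) hM hN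
      ((hc₃.imp hc₁).trans hc) ((hc₄.imp hc₂).trans hc')
    · exact .appP hp (.appP (hε.shiftP2 hr hv) hq)
    · exact .appP hp (.appP (hδ.shiftP2 hr hv) hq)
  | univUniv φ ψ φ' ψ' δ ε δ' ε' =>
    obtain ⟨rfl, _, _, _, _, h₁, h₂, hc, hc'⟩ := h.impStar_inv
    obtain ⟨-, hδ, hε, hc₃, hc₄⟩ := h₁.univ_inv
    obtain ⟨-, hδ', hε', hc₁, hc₂⟩ := h₂.univ_inv
    obtain ⟨hφ, hψ⟩ := hδ.imp_parts
    obtain ⟨hφ', hψ'⟩ := hδ'.imp_parts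
    refine .convE (.univ (.lam_lam (.imp hφ hφ') hψ fun Δ hr hv hp hq => ?_)
      (.lam_lam (.imp hψ hψ') hφ fun Δ hr hv hp hq => ?_)) hM hN
      ((hc₃.imp hc₁).trans hc) ((hc₄.imp hc₂).trans hc')
    · exact .appP (hδ'.shiftP2 hr hv) (.appP hp (.appP (hε.shiftP2 hr hv) hq))
    · exact .appP (hε'.shiftP2 hr hv) (.appP hp (.appP (hδ.shiftP2 hr hv) hq))
  | app N₁ N₂ Q _ ih =>
    obtain ⟨_, L₁, L₂, h₁, h₂, hc, hc'⟩ := h.appE_inv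
    exact .convE (.appE (ih h₁ h₁.path_wf.1 h₁.path_wf.2) h₂ h₂.path_wf.1 h₂.path_wf.2) hM hN hc hc'
  | appRef N₁ N₂ Q hr =>
    obtain ⟨_, L₁, L₂, h₁, h₂, hc, hc'⟩ := h.appE_inv
    obtain ⟨h₃, hc₁, hc₂⟩ := h₁.ref_inv
    have hc₀ := (TmConv.of_red hr).symm
    exact .convE (.appE (.ref (h₃.red_tm hr)) h₂ h₂.path_wf.1 h₂.path_wf.2) hM hN
      (((hc₀.trans hc₁).app _).trans hc) (((hc₀.trans hc₂).app _).trans hc')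
  | impStarL Q _ ih =>
    obtain ⟨rfl, _, _, _, _, h₁, h₂, hc, hc'⟩ := h.impStar_inv
    exact .convE (.impStar (ih h₁ h₁.path_wf.1 h₁.path_wf.2) h₂) hM hN hc hc'
  | impStarR P _ ih =>
    obtain ⟨rfl, _, _, _, _, h₁, h₂, hc, hc'⟩ := h.impStar_inv
    exact .convE (.impStar h₁ (ih h₂ h₂.path_wf.1 h₂.path_wf.2)) hM hN hc hc'

theorem Derives.red_pf {Γ : Ctx} {δ δ' : Prf} {χ : Tm} (h : Derives Γ (.pf δ χ))
    (hr : PrfRed δ δ') : Derives Γ (.pf δ' χ) := by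
  have hχ := h.pf_wf
  have identity : ∀ {φ : Tm}, Derives Γ (.tm φ .omega) →
      Derives Γ (.pf (.lam φ (.var 0)) (.imp φ φ)) :=
    fun hφ => .lamP (.varP (.ctxP hφ) (.here _ _))
  induction hr generalizing χ with
  | beta φ δ ε =>
    obtain ⟨_, ψ, h₁, h₂, hc⟩ := h.appP_inv
    have hs := (CtxSub.ids h.valid).cons_pf (δ := ε) (by rwa [Tm.subst_var])
    have := h₁.lamP_body.2.subst h.valid hs
    rw [Judgement.subst, Tm.subst_var] at this
    exact .convP this hχ hc
  | refPlus φ =>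
    obtain ⟨_, _, h₁, hc⟩ := h.plus_inv
    obtain ⟨h₂, hc₁, hc₂⟩ := h₁.ref_inv
    exact .convP (identity h₂) hχ ((hc₁.imp hc₂).trans hc)
  | refMinus φ =>
    obtain ⟨_, _, h₁, hc⟩ := h.minus_inv
    obtain ⟨h₂, hc₁, hc₂⟩ := h₁.ref_inv
    exact .convP (identity h₂) hχ ((hc₂.imp hc₁).trans hc)
  | app ε _ ih =>
    obtain ⟨_, ψ, h₁, h₂, hc⟩ := h.appP_inv
    exact .convP (.appP (ih h₁ h₁.pf_wf) h₂) hχ hc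
  | univPlus φ ψ δ ε =>
    obtain ⟨_, _, h₁, hc⟩ := h.plus_inv
    obtain ⟨-, hδ, hε, hc₁, hc₂⟩ := h₁.univ_inv
    exact .convP hδ hχ ((hc₁.imp hc₂).trans hc)
  | univMinus φ ψ δ ε =>
    obtain ⟨_, _, h₁, hc⟩ := h.minus_inv
    obtain ⟨-, hδ, hε, hc₁, hc₂⟩ := h₁.univ_inv
    exact .convP hε hχ ((hc₂.imp hc₁).trans hc)
  | plus hr =>
    obtain ⟨_, _, h₁, hc⟩ := h.plus_inv
    exact .convP (.plus (h₁.red_path hr)) hχ hc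
  | minus hr =>
    obtain ⟨_, _, h₁, hc⟩ := h.minus_inv
    exact .convP (.minus (h₁.red_path hr)) hχ hc

theorem Derives.reduces_pf {Γ : Ctx} {δ δ' : Prf} {χ : Tm} (h : Derives Γ (.pf δ χ))
    (hr : PrfReduces δ δ') : Derives Γ (.pf δ' χ) := by
  induction hr with
  | refl => exact h
  | tail _ hr ih => exact ih.red_pf hr

theorem Derives.reduces_path {Γ : Ctx} {P Q : Pth} {M N : Tm} {A : Ty}
    (h : Derives Γ (.path P M A N)) (hr : PthReduces P Q) : Derives Γ (.path Q M A N) := by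
  induction hr with
  | refl => exact h
  | tail _ hr ih => exact ih.red_path hr

/-! ### Computability of proofs and paths between propositions -/

/-- Computable proofs of a canonical proposition. -/
def CPrf : CProp → Prf → Prop
  | .bot, δ => ∃ δ', PrfReduces δ δ' ∧ NeutralPrf δ'
  | .imp θ θ', δ =>
      ((∃ δ', PrfReduces δ δ' ∧ NeutralPrf δ') ∨ ∃ φ ε, PrfReduces δ (.lam φ ε)) ∧
        ∀ ε, CPrf θ ε → CPrf θ' (.app δ ε)

/-- Computability depends only on what a proof and its applications reduce to, and a step in
function position is a step of the application. -/
theorem CPrf.of_reduces {θ : CProp} {δ δ' : Prf} (h : PrfReduces δ δ') (h' : CPrf θ δ') :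
    CPrf θ δ := by
  induction θ generalizing δ δ' with
  | bot => obtain ⟨ε, hr, hn⟩ := h'; exact ⟨ε, h.trans hr, hn⟩
  | imp θ₁ θ₂ _ ih =>
    refine ⟨?_, fun ε hε => ih (h.app ε) (h'.2 ε hε)⟩
    rcases h'.1 with ⟨ε, hr, hn⟩ | ⟨φ, ε, hr⟩
    · exact .inl ⟨ε, h.trans hr, hn⟩
    · exact .inr ⟨φ, ε, h.trans hr⟩

theorem CPrf.of_neutral {θ : CProp} {δ : Prf} (h : NeutralPrf δ) : CPrf θ δ := by
  induction θ generalizing δ with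
  | bot => exact ⟨δ, .refl, h⟩
  | imp θ₁ θ₂ _ ih => exact ⟨.inl ⟨δ, .refl, h⟩, fun ε _ => ih (h.app ε)⟩

theorem CPrf.lam {θ θ' : CProp} {φ : Tm} {δ : Prf} (h : ∀ ε, CPrf θ ε → CPrf θ' (δ.inst ε)) :
    CPrf (.imp θ θ') (.lam φ δ) :=
  ⟨.inr ⟨φ, δ, .refl⟩, fun ε hε => .of_reduces (.single (.beta φ δ ε)) (h ε hε)⟩

theorem CPrf.app {θ θ' : CProp} {δ ε : Prf} (h : CPrf (.imp θ θ') δ) (h' : CPrf θ ε) :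
    CPrf θ' (.app δ ε) := h.2 ε h'

/-- Values of computable paths between the canonical propositions `θ` and `θ'`. -/
inductive PropVal (θ θ' : CProp) : Pth → Prop
  | neutral {P : Pth} : NeutralPth P → PropVal θ θ' P
  | ref (χ : Tm) : θ = θ' → PropVal θ θ' (.ref χ)
  | univ (φ ψ : Tm) {δ ε : Prf} : CPrf (.imp θ θ') δ → CPrf (.imp θ' θ) ε →
      PropVal θ θ' (.univ φ ψ δ ε)

/-- In the reflexivity case the projection reduces to the identity proof. It is computable because
the two ends have the same canonical form; this is the purpose of the equation in `PropVal.ref`. -/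
theorem CPrf.plus {θ θ' : CProp} {P P' : Pth} (h : PthReduces P P') (h' : PropVal θ θ' P') :
    CPrf (.imp θ θ') (.plus P) := by
  refine .of_reduces h.plus ?_
  cases h' with
  | neutral hn => exact .of_neutral (.plus hn)
  | ref χ e => subst e; exact .of_reduces (.single (.refPlus χ)) (.lam fun ε hε => hε)
  | univ φ ψ hδ hε => exact .of_reduces (.single (.univPlus ..)) hδ

theorem CPrf.minus {θ θ' : CProp} {P P' : Pth} (h : PthReduces P P') (h' : PropVal θ θ' P') :
    CPrf (.imp θ' θ) (.minus P) := by
  refine .of_reduces h.minus ?_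
  cases h' with
  | neutral hn => exact .of_neutral (.minus hn)
  | ref χ e => subst e; exact .of_reduces (.single (.refMinus χ)) (.lam fun ε hε => hε)
  | univ φ ψ hδ hε => exact .of_reduces (.single (.univMinus ..)) hε

theorem Prf.shiftP_inst (δ ε : Prf) : δ.shiftP.inst ε = δ := by
  rw [Prf.inst, Prf.shiftP, Prf.subst_rename]
  exact Prf.subst_var δ

/-- The result of two `β`-steps on `(λp. λq. δ) ε ε'`. -/
def Prf.inst₂ (δ ε ε' : Prf) : Prf :=
  (δ.subst .var (cons (.var 0) fun n => (cons ε .var n).shiftP)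
    (fun n => (Pth.var n).shiftP)).inst ε'

theorem Prf.inst₂_app (δ δ' ε ε' : Prf) :
    (Prf.app δ δ').inst₂ ε ε' = .app (δ.inst₂ ε ε') (δ'.inst₂ ε ε') := rfl

theorem Prf.inst₂_zero (ε ε' : Prf) : (Prf.var 0).inst₂ ε ε' = ε' := rfl

theorem Prf.inst₂_one (ε ε' : Prf) : (Prf.var 1).inst₂ ε ε' = ε := Prf.shiftP_inst ε ε'

/-- The components of the `univ` produced by `⊃*` are compositions under two binders. The weakened
proofs in them come back unchanged, so computability reduces to that of ordinary applications. -/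
theorem Prf.inst₂_shiftP2 (δ ε ε' : Prf) : δ.shiftP2.inst₂ ε ε' = δ := by
  rw [Prf.inst₂, Prf.subst_up_inst _ _ _ _ .var, Prf.shiftP2, Prf.subst_rename]
  exact Prf.subst_var δ

theorem CPrf.lam_lam {θ₁ θ₂ θ₃ : CProp} {φ ψ : Tm} {δ : Prf}
    (h : ∀ ε ε', CPrf θ₁ ε → CPrf θ₂ ε' → CPrf θ₃ (δ.inst₂ ε ε')) :
    CPrf (.imp θ₁ (.imp θ₂ θ₃)) (.lam φ (.lam ψ δ)) :=
  .lam fun ε hε => .lam (δ := δ.subst _ _ _) fun ε' hε' => h ε ε' hε hε'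

/-- If either side is neutral, so is the whole path. The four remaining pairs of values are
precisely the redexes for `⊃*`, and the new `univ` components compose computable proofs. -/
theorem PropVal.impStar {θ θ' η η' : CProp} {P Q : Pth} (hP : PropVal θ θ' P)
    (hQ : PropVal η η' Q) :
    ∃ R, PthReduces (.impStar P Q) R ∧ PropVal (.imp θ η) (.imp θ' η') R := by
  cases hP with
  | neutral hn => exact ⟨_, .refl, .neutral (.impStarL _ hn)⟩
  | ref χ e =>
    subst e
    cases hQ with
    | neutral hn => exact ⟨_, .refl, .neutral (.impStarR _ hn)⟩
    | ref χ' e => subst e; exact ⟨_, .single (.refRef _ _), .ref _ rfl⟩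
    | univ φ ψ hδ hε =>
      refine ⟨_, .single (.refUniv ..), .univ _ _ (.lam_lam fun ε ε' h h' => ?_)
        (.lam_lam fun ε ε' h h' => ?_)⟩ <;>
        simp only [Prf.inst₂_app, Prf.inst₂_shiftP2, Prf.inst₂_zero, Prf.inst₂_one]
      · exact hδ.app (h.app h')
      · exact hε.app (h.app h')
  | univ φ ψ hδ hε =>
    cases hQ with
    | neutral hn => exact ⟨_, .refl, .neutral (.impStarR _ hn)⟩
    | ref χ' e =>
      subst e
      refine ⟨_, .single (.univRef ..), .univ _ _ (.lam_lam fun ε ε' h h' => ?_)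
        (.lam_lam fun ε ε' h h' => ?_)⟩ <;>
        simp only [Prf.inst₂_app, Prf.inst₂_shiftP2, Prf.inst₂_zero, Prf.inst₂_one]
      · exact h.app (hε.app h')
      · exact h.app (hδ.app h')
    | univ φ ψ hδ' hε' =>
      refine ⟨_, .single (.univUniv ..), .univ _ _ (.lam_lam fun ε ε' h h' => ?_)
        (.lam_lam fun ε ε' h h' => ?_)⟩ <;>
        simp only [Prf.inst₂_app, Prf.inst₂_shiftP2, Prf.inst₂_zero, Prf.inst₂_one]
      · exact hδ'.app (h.app (hε.app h'))
      · exact hε'.app (h.app (hδ.app h'))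

/-! ### Computability at all types -/

/-- A notion of computable terms and of computable paths between two terms. -/
structure Cand : Type where
  tm : Tm → Prop
  pth : Tm → Tm → Pth → Prop

/-- The path reduces to a neutral path, a reflexivity path or a triple lambda. -/
def FunHead (P : Pth) : Prop :=
  (∃ P', PthReduces P P' ∧ NeutralPth P') ∨ (∃ M, PthReduces P (.ref M)) ∨
    ∃ A Q, PthReduces P (.lll A Q)

/-- Computable paths between functions. -/
def Cand.arrowPth (a b : Cand) (M M' : Tm) (P : Pth) : Prop :=
  FunHead P ∧ ∀ N N' Q, a.tm N → a.tm N' → a.pth N N' Q →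
    b.pth (.app M N) (.app M' N') (.app P N N' Q)

/-- Computable terms and paths at each type. -/
def cand : Ty → Cand
  | .omega =>
    { tm := fun M => ∃ θ : CProp, TmReduces M θ.toTm
      pth := fun M N P => ∃ (θ θ' : CProp) (P' : Pth), TmReduces M θ.toTm ∧
        TmReduces N θ'.toTm ∧ PthReduces P P' ∧ PropVal θ θ' P' }
  | .arrow A B =>
    { tm := fun M => (∀ N, (cand A).tm N → (cand B).tm (.app M N)) ∧
        Cand.arrowPth (cand A) (cand B) M M (.ref M) ∧ Cand.arrowPth (cand A) (cand B) M M M.diag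
      pth := Cand.arrowPth (cand A) (cand B) }

theorem FunHead.of_reduces {P P' : Pth} (h : PthReduces P P') (h' : FunHead P') : FunHead P := by
  rcases h' with ⟨R, hr, hn⟩ | ⟨M, hr⟩ | ⟨A, Q, hr⟩
  · exact .inl ⟨R, h.trans hr, hn⟩
  · exact .inr (.inl ⟨M, h.trans hr⟩)
  · exact .inr (.inr ⟨A, Q, h.trans hr⟩)

theorem cand_pth_of_reduces {A : Ty} {M N : Tm} {P P' : Pth} (h : PthReduces P P')
    (h' : (cand A).pth M N P') : (cand A).pth M N P := by
  induction A generalizing M N P P' with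
  | omega =>
    obtain ⟨θ, θ', R, h₁, h₂, hr, hv⟩ := h'
    exact ⟨θ, θ', R, h₁, h₂, h.trans hr, hv⟩
  | arrow A B _ ih =>
    exact ⟨h'.1.of_reduces h, fun N N' Q hN hN' hQ => ih (h.app N N' Q) (h'.2 N N' Q hN hN' hQ)⟩

/-- The ends matter at `Ω` only through their canonical forms, which convertible terms share; at
function types convertibility passes to applications. -/
theorem cand_pth_of_conv {A : Ty} {M M' N N' : Tm} {P : Pth} (h : TmConv M M') (h' : TmConv N N')
    (hP : (cand A).pth M N P) : (cand A).pth M' N' P := by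
  induction A generalizing M M' N N' P with
  | omega =>
    obtain ⟨θ, θ', R, h₁, h₂, hr, hv⟩ := hP
    exact ⟨θ, θ', R, h.reduces h₁, h'.reduces h₂, hr, hv⟩
  | arrow A B _ ih =>
    exact ⟨hP.1, fun L L' Q hL hL' hQ => ih (h.app L) (h'.app L') (hP.2 L L' Q hL hL' hQ)⟩

/-- Each of the three requirements at a function type expands along its own reduction: application
for terms, `appRef` for the reflexivity, and `TmRed.pathSubst` for the diagonal path. -/
theorem cand_tm_of_red {A : Ty} {M M' : Tm} (h : TmRed M M') (h' : (cand A).tm M') :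
    (cand A).tm M := by
  induction A generalizing M M' with
  | omega => obtain ⟨θ, hθ⟩ := h'; exact ⟨θ, .head h hθ⟩
  | arrow A B _ ih =>
    have hc := (TmConv.of_red h).symm
    obtain ⟨h₁, h₂, h₃⟩ := h'
    refine ⟨fun N hN => ih (.app N h) (h₁ N hN), ⟨.inr (.inl ⟨M, .refl⟩), ?_⟩, ?_⟩
    · intro N N' Q hN hN' hQ
      exact cand_pth_of_reduces (.single (.appRef N N' Q h))
        (cand_pth_of_conv (hc.app N) (hc.app N') (h₂.2 N N' Q hN hN' hQ))
    · exact cand_pth_of_conv (A := .arrow A B) hc hc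
        (cand_pth_of_reduces (A := .arrow A B) (.single (h.pathSubst _ _ _)) h₃)

theorem cand_pth_ref {A : Ty} {M : Tm} (h : (cand A).tm M) : (cand A).pth M M (.ref M) := by
  cases A with
  | omega => obtain ⟨θ, hθ⟩ := h; exact ⟨θ, θ, _, hθ, hθ, .refl, .ref _ rfl⟩
  | arrow A B => exact h.2.1

theorem cand_pth_diag {A : Ty} {M : Tm} (h : (cand A).tm M) : (cand A).pth M M M.diag := by
  cases A with
  | omega =>
    obtain ⟨θ, hθ⟩ := h
    exact ⟨θ, θ, _, hθ, hθ, (TmReduces.diag hθ).trans θ.diag_reduces, .ref _ rfl⟩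
  | arrow A B => exact h.2.2

/-- Applying a neutral path leaves it neutral. The ends must be computable because a path at `Ω` is
required to have ends with canonical forms. -/
theorem cand_pth_of_neutral {A : Ty} {M N : Tm} {P : Pth} (hM : (cand A).tm M)
    (hN : (cand A).tm N) (h : NeutralPth P) : (cand A).pth M N P := by
  induction A generalizing M N P with
  | omega =>
    obtain ⟨θ, hθ⟩ := hM
    obtain ⟨θ', hθ'⟩ := hN
    exact ⟨θ, θ', P, hθ, hθ', .refl, .neutral h⟩
  | arrow A B _ ih =>
    exact ⟨.inl ⟨P, .refl, h⟩, fun L L' Q hL hL' _ => ih (hM.1 L hL) (hN.1 L' hL') (h.app L L' Q)⟩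

theorem cand_pth_impStar {φ φ' ψ ψ' : Tm} {P Q : Pth} (hP : (cand .omega).pth φ φ' P)
    (hQ : (cand .omega).pth ψ ψ' Q) :
    (cand .omega).pth (.imp φ ψ) (.imp φ' ψ') (.impStar P Q) := by
  obtain ⟨θ, θ', P', h₁, h₂, hr, hv⟩ := hP
  obtain ⟨η, η', Q', h₁', h₂', hr', hv'⟩ := hQ
  obtain ⟨R, hR, hV⟩ := hv.impStar hv'
  exact ⟨.imp θ η, .imp θ' η', R, h₁.imp h₁', h₂.imp h₂', (hr.impStar hr').trans hR, hV⟩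

theorem cand_tm_imp {φ ψ : Tm} (hφ : (cand .omega).tm φ) (hψ : (cand .omega).tm ψ) :
    (cand .omega).tm (.imp φ ψ) := by
  obtain ⟨θ, h⟩ := hφ
  obtain ⟨θ', h'⟩ := hψ
  exact ⟨.imp θ θ', h.imp h'⟩

/-! ### The fundamental theorem for terms -/

/-- `σ` sends the term variables of `Γ` to computable terms. -/
def CTmSub (Γ : Ctx) (σ : ℕ → Tm) : Prop := ∀ n A, Γ.HasTm n A → (cand A).tm (σ n)

/-- `τ` sends the term variables of `Γ` to computable paths from their values under `ρ` to those
under `σ`. -/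
def CPthSub (Γ : Ctx) (τ : ℕ → Pth) (ρ σ : ℕ → Tm) : Prop :=
  ∀ n A, Γ.HasTm n A → (cand A).pth (ρ n) (σ n) (τ n)

theorem CTmSub.cons {Γ : Ctx} {σ : ℕ → Tm} {A : Ty} {N : Tm} (h : CTmSub Γ σ)
    (hN : (cand A).tm N) : CTmSub (.tm Γ A) (cons N σ) := by
  intro n B hn
  cases hn with
  | here => exact hN
  | tm _ hn => exact h _ _ hn

theorem CPthSub.cons {Γ : Ctx} {τ : ℕ → Pth} {ρ σ : ℕ → Tm} {A : Ty} {N N' : Tm} {P : Pth}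
    (h : CPthSub Γ τ ρ σ) (hP : (cand A).pth N N' P) :
    CPthSub (.tm Γ A) (cons P τ) (cons N ρ) (cons N' σ) := by
  intro n B hn
  cases hn with
  | here => exact hP
  | tm _ hn => exact h _ _ hn

/-- Terms are mapped to computable terms and to computable paths. -/
theorem Derives.cand_tm {Γ : Ctx} {M : Tm} {A : Ty} (h : Derives Γ (.tm M A)) :
    (∀ σ, CTmSub Γ σ → (cand A).tm (M.subst σ)) ∧
    ∀ τ ρ σ, CTmSub Γ ρ → CTmSub Γ σ → CPthSub Γ τ ρ σ →
      (cand A).pth (M.subst ρ) (M.subst σ) (M.pathSubst τ ρ σ) := by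
  induction M generalizing Γ A with
  | var n =>
    cases h with
    | varT _ hn => exact ⟨fun σ hσ => hσ _ _ hn, fun τ ρ σ _ _ hτ => hτ _ _ hn⟩
  | bot =>
    cases h with
    | bot => exact ⟨fun σ _ => ⟨.bot, .refl⟩, fun τ ρ σ _ _ _ =>
        ⟨.bot, .bot, _, .refl, .refl, .refl, .ref _ rfl⟩⟩
  | imp φ ψ ih₁ ih₂ =>
    cases h with
    | imp h₁ h₂ => exact ⟨fun σ hσ => cand_tm_imp ((ih₁ h₁).1 σ hσ) ((ih₂ h₂).1 σ hσ),
        fun τ ρ σ hρ hσ hτ => cand_pth_impStar ((ih₁ h₁).2 τ ρ σ hρ hσ hτ)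
          ((ih₂ h₂).2 τ ρ σ hρ hσ hτ)⟩
  | app M N ih₁ ih₂ =>
    cases h with
    | appT h₁ h₂ => exact ⟨fun σ hσ => ((ih₁ h₁).1 σ hσ).1 _ ((ih₂ h₂).1 σ hσ),
        fun τ ρ σ hρ hσ hτ => ((ih₁ h₁).2 τ ρ σ hρ hσ hτ).2 _ _ _ ((ih₂ h₂).1 ρ hρ)
          ((ih₂ h₂).1 σ hσ) ((ih₂ h₂).2 τ ρ σ hρ hσ hτ)⟩
  | lam A M ih =>
    cases h with
    | @lamT _ _ _ B h =>
      obtain ⟨ih₁, ih₂⟩ := ih h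
      -- The path statement comes first: the diagonal path required of the abstraction is its
      -- instance with equal ends and with the diagonals of the values of `σ`.
      have key : ∀ τ ρ σ, CTmSub Γ ρ → CTmSub Γ σ → CPthSub Γ τ ρ σ →
          (cand (.arrow A B)).pth ((Tm.lam A M).subst ρ) ((Tm.lam A M).subst σ)
            ((Tm.lam A M).pathSubst τ ρ σ) := by
        intro τ ρ σ hρ hσ hτ
        refine ⟨.inr (.inr ⟨_, _, .refl⟩), fun N N' Q hN hN' hQ => ?_⟩
        refine cand_pth_of_reduces (.single (.beta ..)) ?_
        rw [Tm.pathSubst_up_inst]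
        exact cand_pth_of_conv (TmConv.lam_subst_app ..).symm (TmConv.lam_subst_app ..).symm
          (ih₂ _ _ _ (hρ.cons hN) (hσ.cons hN') (hτ.cons hQ))
      refine ⟨fun σ hσ => ⟨fun N hN => ?_, ⟨.inr (.inl ⟨_, .refl⟩), fun N N' Q hN hN' hQ => ?_⟩, ?_⟩,
        key⟩
      · refine cand_tm_of_red (.beta ..) ?_
        rw [Tm.subst_upTm_inst]
        exact ih₁ _ (hσ.cons hN)
      · refine cand_pth_of_reduces (.single (.refLam ..)) ?_
        -- The contractum is again a path substitution in `M`, now with diagonals for the variables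
        -- of `Γ`, so the induction hypothesis for paths applies.
        rw [Tm.subst_upTm_pathInst]
        exact cand_pth_of_conv (TmConv.lam_subst_app ..).symm (TmConv.lam_subst_app ..).symm
          (ih₂ _ _ _ (hσ.cons hN) (hσ.cons hN')
            (CPthSub.cons (fun n B hn => cand_pth_diag (hσ n B hn)) hQ))
      · rw [Tm.diag_subst]
        exact key _ _ _ hσ hσ fun n B hn => cand_pth_diag (hσ n B hn)

/-! ### The fundamental theorem for proofs and paths -/

/-- Computable proofs of a proposition that has a canonical form. -/
def CPrfOf (φ : Tm) (δ : Prf) : Prop := ∃ θ : CProp, TmReduces φ θ.toTm ∧ CPrf θ δ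

theorem CPrfOf.of_conv {φ ψ : Tm} {δ : Prf} (h : TmConv φ ψ) (hδ : CPrfOf φ δ) : CPrfOf ψ δ := by
  obtain ⟨θ, h₁, h₂⟩ := hδ; exact ⟨θ, h.reduces h₁, h₂⟩

theorem CPrfOf.app {φ ψ : Tm} {δ ε : Prf} (hδ : CPrfOf (.imp φ ψ) δ) (hε : CPrfOf φ ε) :
    CPrfOf ψ (.app δ ε) := by
  obtain ⟨θ, h₁, h₂⟩ := hδ
  obtain ⟨θ₁, θ₂, rfl, h₃, h₄⟩ := h₁.imp_canon
  obtain ⟨θ', h₅, h₆⟩ := hε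
  obtain rfl := h₅.canon_unique h₃
  exact ⟨θ₂, h₄, h₂.app h₆⟩

/-- A computable substitution for all the variables of `Γ`. -/
structure CSub (Γ : Ctx) (σ : ℕ → Tm) (π : ℕ → Prf) (κ : ℕ → Pth) : Prop where
  tm : CTmSub Γ σ
  pf : ∀ n φ, Γ.HasPf n φ → CPrfOf (φ.subst σ) (π n)
  path : ∀ n M A N, Γ.HasPath n M A N → (cand A).pth (M.subst σ) (N.subst σ) (κ n)

theorem CSub.cons_tm {Γ : Ctx} {σ : ℕ → Tm} {π : ℕ → Prf} {κ : ℕ → Pth} {A : Ty} {N : Tm}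
    (h : CSub Γ σ π κ) (hN : (cand A).tm N) : CSub (.tm Γ A) (cons N σ) π κ where
  tm := h.tm.cons hN
  pf n φ hn := by
    cases hn with
    | tm _ hn => rw [Tm.shift_subst_cons]; exact h.pf _ _ hn
  path n M B N hn := by
    cases hn with
    | tm _ hn => simp only [Tm.shift_subst_cons]; exact h.path _ _ _ _ hn

theorem CSub.cons_pf {Γ : Ctx} {σ : ℕ → Tm} {π : ℕ → Prf} {κ : ℕ → Pth} {φ : Tm} {δ : Prf}
    (h : CSub Γ σ π κ) (hδ : CPrfOf (φ.subst σ) δ) : CSub (.pf Γ φ) σ (cons δ π) κ where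
  tm n A hn := by
    cases hn with
    | pf _ hn => exact h.tm _ _ hn
  pf n φ hn := by
    cases hn with
    | here => exact hδ
    | pf _ hn => exact h.pf _ _ hn
  path n M B N hn := by
    cases hn with
    | pf _ hn => exact h.path _ _ _ _ hn

theorem CSub.cons_path {Γ : Ctx} {σ : ℕ → Tm} {π : ℕ → Prf} {κ : ℕ → Pth} {M N : Tm} {A : Ty}
    {P : Pth} (h : CSub Γ σ π κ) (hP : (cand A).pth (M.subst σ) (N.subst σ) P) :
    CSub (.path Γ M A N) σ π (cons P κ) where
  tm n A hn := by
    cases hn with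
    | path _ _ _ hn => exact h.tm _ _ hn
  pf n φ hn := by
    cases hn with
    | path _ _ _ hn => exact h.pf _ _ hn
  path n M B N hn := by
    cases hn with
    | here => exact hP
    | path _ _ _ hn => exact h.path _ _ _ _ hn

/-- The interpretation of a judgement under a substitution. -/
def Judgement.Computable (σ : ℕ → Tm) (π : ℕ → Prf) (κ : ℕ → Pth) : Judgement → Prop
  | .valid => True
  | .tm M A => (cand A).tm (M.subst σ)
  | .pf δ φ => CPrfOf (φ.subst σ) (δ.subst σ π κ)
  | .path P M A N => (cand A).pth (M.subst σ) (N.subst σ) (P.subst σ π κ)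

theorem Derives.computable {Γ : Ctx} {J : Judgement} (h : Derives Γ J) {σ : ℕ → Tm} {π : ℕ → Prf}
    {κ : ℕ → Pth} (hs : CSub Γ σ π κ) : J.Computable σ π κ := by
  induction h generalizing σ π κ with
  | ctxNil | ctxT | ctxP | ctxE => trivial
  | varT _ hn => exact hs.tm _ _ hn
  | varP _ hn => exact hs.pf _ _ hn
  | varE _ hn => exact hs.path _ _ _ _ hn
  | bot => exact ⟨.bot, .refl⟩
  | imp _ _ ih ih' => exact cand_tm_imp (ih hs) (ih' hs)
  | appT _ _ ih ih' => exact (ih hs).1 _ (ih' hs)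
  | lamT h _ => exact (Derives.lamT h).cand_tm.1 σ hs.tm
  | appP _ _ ih ih' => exact (ih hs).app (ih' hs)
  | @lamP Γ δ φ ψ h ih =>
    obtain ⟨θ, hθ⟩ := h.prop_of_pf.cand_tm.1 σ hs.tm
    -- The canonical form of the conclusion must be fixed before an argument is given. It is read
    -- off at a neutral argument, and uniqueness identifies it below with the form obtained at `ε`.
    obtain ⟨θ', hθ', -⟩ := ih (hs.cons_pf ⟨θ, hθ, .of_neutral (.var 0)⟩)
    refine ⟨.imp θ θ', hθ.imp hθ', .lam fun ε hε => ?_⟩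
    rw [Prf.subst_up_inst]
    obtain ⟨θ'', h₁, h₂⟩ := ih (hs.cons_pf ⟨θ, hθ, hε⟩)
    exact h₁.canon_unique hθ' ▸ h₂
  | convP _ _ hc ih _ => exact (ih hs).of_conv (hc.subst σ)
  | ref _ ih => exact cand_pth_ref (ih hs)
  | impStar _ _ ih ih' => exact cand_pth_impStar (ih hs) (ih' hs)
  | univ _ _ ih ih' =>
    obtain ⟨θ, h₁, h₂⟩ := ih hs
    obtain ⟨θ', h₁', h₂'⟩ := ih' hs
    obtain ⟨θ₁, θ₂, rfl, ha, hb⟩ := h₁.imp_canon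
    obtain ⟨θ₁', θ₂', rfl, ha', hb'⟩ := h₁'.imp_canon
    -- The two proofs give canonical forms for the ends independently; uniqueness makes them agree
    -- crosswise.
    obtain rfl := ha.canon_unique hb'
    obtain rfl := hb.canon_unique ha'
    exact ⟨_, _, _, ha, hb, .refl, .univ _ _ h₂ h₂'⟩
  | plus _ ih =>
    obtain ⟨θ, θ', P', h₁, h₂, hr, hv⟩ := ih hs
    exact ⟨.imp θ θ', h₁.imp h₂, .plus hr hv⟩
  | minus _ ih =>
    obtain ⟨θ, θ', P', h₁, h₂, hr, hv⟩ := ih hs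
    exact ⟨.imp θ' θ, h₂.imp h₁, .minus hr hv⟩
  | lll _ _ _ ih _ _ =>
    refine ⟨.inr (.inr ⟨_, _, .refl⟩), fun N N' Q hN hN' hQ => ?_⟩
    refine cand_pth_of_reduces (.single (.beta ..)) ?_
    rw [Pth.subst_up_inst]
    have := ih (((hs.cons_tm hN).cons_tm hN').cons_path (M := .var 1) (N := .var 0) hQ)
    simp only [Judgement.Computable, Tm.subst, Tm.shift2_subst_cons_cons] at this
    exact this
  | appE _ _ _ _ ih₁ ih₂ ih₃ ih₄ => exact (ih₁ hs).2 _ _ _ (ih₃ hs) (ih₄ hs) (ih₂ hs)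
  | convE _ _ _ hc hc' ih _ _ => exact cand_pth_of_conv (hc.subst σ) (hc'.subst σ) (ih hs)

/-! ### Canonicity -/

theorem Ctx.NoTermVars.not_hasTm {Γ : Ctx} (hΓ : Γ.NoTermVars) {n : ℕ} {A : Ty} :
    ¬ Γ.HasTm n A := by
  intro h
  induction h with
  | here | tm => exact hΓ
  | pf _ _ ih => exact ih hΓ
  | path _ _ _ _ ih => exact ih hΓ

/-- Without term variables the term part is vacuous, so the types of the declared proof and path
variables already have computable interpretations. The variables themselves are neutral. -/
theorem CSub.ids {Γ : Ctx} (hΓ : Γ.NoTermVars) (h : Derives Γ .valid) :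
    CSub Γ .var .var .var := by
  have ht : CTmSub Γ .var := fun _ _ hn => absurd hn hΓ.not_hasTm
  refine ⟨ht, fun n φ hn => ?_, fun n M A N hn => ?_⟩
  · obtain ⟨θ, hθ⟩ := (Derives.of_hasPf hn h).cand_tm.1 _ ht
    exact ⟨θ, hθ, .of_neutral (.var n)⟩
  · obtain ⟨hM, hN⟩ := Derives.of_hasPath hn h
    exact cand_pth_of_neutral (hM.cand_tm.1 _ ht) (hN.cand_tm.1 _ ht) (.var n)

theorem Derives.cprfOf {Γ : Ctx} (hΓ : Γ.NoTermVars) {δ : Prf} {φ : Tm}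
    (h : Derives Γ (.pf δ φ)) : CPrfOf φ δ := by
  have := h.computable (.ids hΓ h.valid)
  rwa [Judgement.Computable, Tm.subst_var, Prf.subst_var] at this

theorem Derives.cand_pth {Γ : Ctx} (hΓ : Γ.NoTermVars) {P : Pth} {M N : Tm} {A : Ty}
    (h : Derives Γ (.path P M A N)) : (cand A).pth M N P := by
  have := h.computable (.ids hΓ h.valid)
  rwa [Judgement.Computable, Tm.subst_var, Tm.subst_var, Pth.subst_var] at this

end PHOML

theorem mainTheorem1 (Γ : Ctx) (hΓ : Γ.NoTermVars) :
    (∀ δ : Prf, Derives Γ (.pf δ .bot) →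
      ∃ δ', PrfReduces δ δ' ∧ NeutralPrf δ') ∧
    (∀ (δ : Prf) (φ ψ : Tm), Derives Γ (.pf δ (.imp φ ψ)) →
      (∃ δ', PrfReduces δ δ' ∧ NeutralPrf δ') ∨
      (∃ (φ' : Tm) (ε : Prf), PrfReduces δ (.lam φ' ε) ∧ TmConv φ φ' ∧
        Derives (.pf Γ φ) (.pf ε ψ))) ∧
    (∀ (P : Pth) (φ ψ : Tm), Derives Γ (.path P φ .omega ψ) →
      (∃ P', PthReduces P P' ∧ NeutralPth P') ∨
      (∃ χ : Tm, PthReduces P (.ref χ) ∧ TmConv φ ψ ∧ TmConv ψ χ) ∨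
      (∃ (φ' ψ' : Tm) (δ ε : Prf), PthReduces P (.univ φ' ψ' δ ε) ∧
        TmConv φ φ' ∧ TmConv ψ ψ' ∧
        Derives Γ (.pf δ (.imp φ ψ)) ∧ Derives Γ (.pf ε (.imp ψ φ)))) ∧
    (∀ (P : Pth) (M M' : Tm) (A B : Ty), Derives Γ (.path P M (.arrow A B) M') →
      (∃ P', PthReduces P P' ∧ NeutralPth P') ∨
      (∃ N : Tm, PthReduces P (.ref N) ∧ TmConv M M' ∧ TmConv M' N) ∨
      (∃ Q : Pth, PthReduces P (.lll A Q) ∧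
        Derives (Γ.ext3 A)
          (.path Q (.app M.shift2 (.var 1)) B (.app M'.shift2 (.var 0))))) := by
  refine ⟨fun δ h => ?_, fun δ φ ψ h => ?_, fun P φ ψ h => ?_, fun P M M' A B h => ?_⟩
  · obtain ⟨θ, hθ, hδ⟩ := h.cprfOf hΓ
    -- The term `⊥` is its own canonical form, and at that form computability is reduction to a
    -- neutral proof.
    obtain rfl : CProp.bot = θ := TmReduces.canon_unique (M := .bot) .refl hθ
    exact hδ
  · obtain ⟨θ, hθ, hδ⟩ := h.cprfOf hΓ
    obtain ⟨θ₁, θ₂, rfl, -⟩ := hθ.imp_canon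
    rcases hδ.1 with hn | ⟨φ', ε, hr⟩
    · exact .inl hn
    · exact .inr ⟨φ', ε, hr, (h.reduces_pf hr).lamP_body⟩
  · obtain ⟨θ, θ', P', -, -, hr, hv⟩ := h.cand_pth hΓ
    have h' := h.reduces_path hr
    cases hv with
    | neutral hn => exact .inl ⟨P', hr, hn⟩
    | ref χ _ =>
      obtain ⟨-, h₁, h₂⟩ := h'.ref_inv
      exact .inr (.inl ⟨χ, hr, h₁.symm.trans h₂, h₂.symm⟩)
    | univ φ' ψ' =>
      obtain ⟨-, hδ, hε, h₁, h₂⟩ := h'.univ_inv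
      obtain ⟨hφ, hψ⟩ := h.path_wf
      exact .inr (.inr ⟨φ', ψ', _, _, hr, h₁.symm, h₂.symm,
        .convP hδ (.imp hφ hψ) (h₁.imp h₂), .convP hε (.imp hψ hφ) (h₂.imp h₁)⟩)
  · rcases (h.cand_pth hΓ).1 with hn | ⟨N, hr⟩ | ⟨A', Q, hr⟩
    · exact .inl hn
    · obtain ⟨-, h₁, h₂⟩ := (h.reduces_path hr).ref_inv
      exact .inr (.inl ⟨N, hr, h₁.symm.trans h₂, h₂.symm⟩)
    · have h' := h.reduces_path hr
      -- Computability leaves the annotation `A'` of the triple lambda arbitrary; typing of the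
      -- reduct forces it to be `A`.
      obtain ⟨_, _, _, e, -⟩ := h'.lll_inv
      cases e
      exact .inr (.inr ⟨Q, hr, h'.lll_body⟩)
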